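/- Let $m\ge 1$ be an integer and let $(p_0,\dots,p_m)$ be a probability vector. Let $\zeta_m$ be the random noble means substitution on $\{a,b\}$: independently for each letter, $a\mapsto a^{i}ba^{m-i}$ with probability $p_i$ ($0\le i\le m$) and $b\mapsto a$. Its substitution matrix is $\begin{pmatrix} m&1\\1&0\end{pmatrix}$, with leading eigenvalue $\lambda_m=\frac{m+\sqrt{m^2+4}}{2}$ and left eigenvector $(\lambda_m,1)$; words are realised geometrically by replacing $a$ by an interval of length $\lambda_m$ and $b$ by an interval of length $1$, and taking the left endpoints of the intervals. Let $w^{(n)}=\zeta_m^n(b)$ be the $n$-th random inflation word, and let $A_n(k)=\mathbb E\big[\sum_{j=1}^{|w^{(n)}|}e^{-2\pi \mathrm i kx_j}\big]$ be its mean Fourier amplitude, where $x_1=0<x_2<\cdots$ are the left endpoints in the patch of $w^{(n)}$ starting at $0$. Let $\mu_m$ be the law of the bi-infinite noble means words, i.e. the probability measure on $\{a,b\}^{\mathbb Z}$ for which the probability of seeing a finite word $v$ at any given position is the mean frequency $\lim_{n\to\infty}\mathbb E[\#\text{ of occurrences of }v\text{ in }w^{(n)}]/\mathbb E|w^{(n)}|$.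 Then for every wave number $k\in\mathbb R\setminus\frac{\mathbb Z[\lambda_m]}{\sqrt{m^2+4}}$ (that is, for every $k$ outside the Fourier module, be it in $\mathbb Q(\lambda_m)$ or not) the diffraction intensity $I(k)$ vanishes, in both of the following senses: 1. $\displaystyle\lim_{n\to\infty}\frac{|A_n(k)|^2}{\lambda_m^{2n}}=0$; 2. for $\mu_m$-almost every bi-infinite word, with $\Lambda\subset\mathbb R$ the set of left endpoints of its tiling of the line (one endpoint being at $0$), every diffraction measure of $\Lambda$ gives mass $0$ to $\{k\}$. Here an autocorrelation $\gamma$ of $\Lambda$ is a vague accumulation point of $\frac{1}{2n}\sum_{x,y\in\Lambda\cap[-n,n]}\delta_{x-y}$ as $n\to\infty$, and a diffraction measure of $\Lambda$ is a positive measure that is the Fourier transform $\widehat\gamma$ of an autocorrelation $\gamma$. -/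

import Mathlib

open MeasureTheory Filter Topology
open scoped SchwartzMap FourierTransform

noncomputable section

namespace RNMS

/-- The binary alphabet. -/
inductive Letter where
  | a : Letter
  | b : Letter
  deriving DecidableEq

instance : MeasurableSpace Letter := ⊤

/-! ### Random substitutions -/

/-- A random substitution: every letter is sent to a random word. -/
abbrev RandomSubstitution (α : Type) := α → PMF (List α)

/-- The law of the image of a word: the letters are substituted independently of each other, and
the resulting words are concatenated. -/
def RandomSubstitution.onWord {α : Type} (ρ : RandomSubstitution α) : List α → PMF (List α)
  | [] => PMF.pure []
  | x :: w => (ρ x).bind fun u => (ρ.onWord w).map fun v => u ++ v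

/-- The law of the `n`-th random inflation word obtained from the one-letter word `x`. -/
def RandomSubstitution.iterate {α : Type} (ρ : RandomSubstitution α) (x : α) : ℕ → PMF (List α)
  | 0 => PMF.pure [x]
  | n + 1 => (ρ.iterate x n).bind ρ.onWord

/-- The random noble means substitution: `a ↦ aⁱ b aᵐ⁻ⁱ` with probability `p i`
(`0 ≤ i ≤ m`), and `b ↦ a`. -/
def nobleMeans (m : ℕ) (p : PMF (Fin (m + 1))) : RandomSubstitution Letter
  | .a => p.map fun i =>
      List.replicate (i : ℕ) Letter.a ++ Letter.b :: List.replicate (m - (i : ℕ)) Letter.a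
  | .b => PMF.pure [Letter.a]

/-- The law of the random word `w⁽ⁿ⁾ = ζₘⁿ(b)`. -/
def wordLaw (m : ℕ) (p : PMF (Fin (m + 1))) (n : ℕ) : PMF (List Letter) :=
  (nobleMeans m p).iterate Letter.b n

/-- The expectation of `f(w⁽ⁿ⁾)`; the sum has only finitely many nonzero terms. -/
def wordMean {E : Type} [NormedAddCommGroup E] [NormedSpace ℝ E]
    (m : ℕ) (p : PMF (Fin (m + 1))) (n : ℕ) (f : List Letter → E) : E :=
  ∑' w : List Letter, (wordLaw m p n w).toReal • f w

/-! ### Geometric realisation -/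

/-- The inflation multiplier `λₘ`, the leading eigenvalue of `!![m, 1; 1, 0]`. -/
def lam (m : ℕ) : ℝ := (m + √((m : ℝ) ^ 2 + 4)) / 2

/-- The Fourier module `ℤ[λₘ] / √(m² + 4)`. -/
def fourierModule (m : ℕ) : Set ℝ :=
  {k | ∃ z ∈ Algebra.adjoin ℤ {lam m}, k = z / √((m : ℝ) ^ 2 + 4)}

/-- The tile lengths, given by the left eigenvector `(λₘ, 1)` of the substitution matrix. -/
def tileLength (m : ℕ) : Letter → ℝ
  | .a => lam m
  | .b => 1

/-- The left endpoint of the `j`-th tile (`j = 0, 1, …`) of the patch given by the finite word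
`w`, which starts at the origin. -/
def patchPoint (m : ℕ) (w : List Letter) (j : ℕ) : ℝ :=
  ((w.take j).map (tileLength m)).sum

/-- The (unnormalised) Fourier amplitude of the geometric patch given by a finite word. -/
def patchAmplitude (m : ℕ) (k : ℝ) (w : List Letter) : ℂ :=
  ∑ j ∈ Finset.range w.length, Complex.exp (-2 * Real.pi * Complex.I * k * patchPoint m w j)

/-- The mean amplitude `Aₙ(k)` of the random patch given by `w⁽ⁿ⁾`. -/
def meanAmplitude (m : ℕ) (p : PMF (Fin (m + 1))) (k : ℝ) (n : ℕ) : ℂ :=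
  wordMean m p n (patchAmplitude m k)

/-- The left endpoint of the `j`-th tile of the tiling of the line given by the bi-infinite word
`x`; the tile with index `0` starts at the origin. -/
def tilingPoint (m : ℕ) (x : ℤ → Letter) (j : ℤ) : ℝ :=
  ∑ i ∈ Finset.Ico 0 j, tileLength m (x i) - ∑ i ∈ Finset.Ico j 0, tileLength m (x i)

/-- The point set of all left endpoints of the tiling given by the bi-infinite word `x`. -/
def pointSet (m : ℕ) (x : ℤ → Letter) : Set ℝ := Set.range (tilingPoint m x)

/-! ### The law of the bi-infinite words -/

/-- The number of occurrences of `v` as a subword of `w`. -/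
def occurrences (v w : List Letter) : ℕ :=
  {j ∈ Finset.range w.length | v <+: w.drop j}.card

/-- The cylinder set of the bi-infinite words that show the word `v` from position `t` on. -/
def cylinder (t : ℤ) (v : List Letter) : Set (ℤ → Letter) :=
  {x | ∀ (i : ℕ) (h : i < v.length), x (t + i) = v[i]}

/-- `μ` is the law of the random noble means words on the two-sided shift space: the probability
of seeing the word `v` at a given position is the mean frequency of `v` in the random words
`ζₘⁿ(b)` as `n → ∞`. -/
def IsNobleMeansLaw (m : ℕ) (p : PMF (Fin (m + 1))) (μ : Measure (ℤ → Letter)) : Prop :=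
  IsProbabilityMeasure μ ∧
    ∀ (t : ℤ) (v : List Letter),
      Tendsto (fun n : ℕ => wordMean m p n (fun w => (occurrences v w : ℝ)) /
          wordMean m p n (fun w => (w.length : ℝ)))
        atTop (𝓝 (μ.real (cylinder t v)))

/-! ### Autocorrelation and diffraction -/

/-- The Dirac comb of a point set. -/
def diracComb (P : Set ℝ) : Measure ℝ := Measure.sum fun x : P => Measure.dirac (x : ℝ)

/-- The finite-volume autocorrelation `δ_{Pₙ} ∗ δ_{-Pₙ} / vol(Bₙ)` with `Pₙ = P ∩ Bₙ(0)`. -/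
def finiteAutocorrelation (P : Set ℝ) (n : ℕ) : Measure ℝ :=
  (volume (Metric.closedBall (0 : ℝ) n))⁻¹ •
    (diracComb (P ∩ Metric.closedBall 0 n)).conv
      ((diracComb (P ∩ Metric.closedBall 0 n)).map fun x => -x)

/-- `γ` is an autocorrelation of `P`: a limit, in the vague topology, of a subsequence of the
finite-volume autocorrelations. -/
def IsAutocorrelation (P : Set ℝ) (γ : Measure ℝ) : Prop :=
  IsLocallyFiniteMeasure γ ∧ ∃ u : ℕ → ℕ, StrictMono u ∧
    ∀ f : ℝ → ℝ, Continuous f → HasCompactSupport f →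
      Tendsto (fun n => ∫ x, f x ∂(finiteAutocorrelation P (u n))) atTop (𝓝 (∫ x, f x ∂γ))

/-- The measure `ν` is the Fourier transform of the measure `γ` (as tempered distributions). -/
def IsFourierTransform (γ ν : Measure ℝ) : Prop :=
  IsLocallyFiniteMeasure ν ∧ ∀ φ : 𝓢(ℝ, ℂ),
    Integrable (fun t => φ t) ν ∧ Integrable (fun x => (𝓕 φ) x) γ ∧
      ∫ x, (𝓕 φ) x ∂γ = ∫ t, φ t ∂ν

/-- `ν` is a diffraction measure of the point set `P`: the Fourier transform of an
autocorrelation of `P`. -/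
def IsDiffractionMeasure (P : Set ℝ) (ν : Measure ℝ) : Prop :=
  ∃ γ : Measure ℝ, IsAutocorrelation P γ ∧ IsFourierTransform γ ν

end RNMS

end

/-!
The diffraction intensity of the random noble means inflation vanishes outside the Fourier module.

*Mean amplitudes.* A level-`n` inflation word of `a` is a concatenation of `m` independent
level-`(n-1)` words of `a` and one of `b`, and all realisations of an inflation word have the same
length. So the mean amplitude of `a` at level `n + 2`, divided by `λₘⁿ⁺²`, is a convex combination
of the relative amplitudes at levels `n + 1` and `n`, each multiplied by a product of the phases
`exp(-2πikλₘʲ)` (`relAmplitude_add_two`). Their moduli therefore converge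
(`exists_tendsto_of_le_convex`), and the variance identity for convex combinations shows that all
summands of positive weight align asymptotically (`tendsto_relAmplitude_sub_summand`). If the limit
of the moduli is not zero, then the alignment forces `exp(-2πikλₘⁿ) → 1`, which by the Pisot
property of `λₘ` places `k` in the Fourier module (`mem_fourierModule_of_tendsto`).

*Second moments.* Let `g` be a smooth window of length `R`, with an `L¹` norm independent of `R`,
modulated by `k`. A sum of `g` over the points of an inflated word splits into the contributions of
the level-`N` supertiles, which are independent, at deterministic places. The second moment is at
most the square of the mean, which is small by the decay of the mean amplitudes when `N` is large, plus
the sum of the second moments of the individual contributions, which tends to zero as `R → ∞` with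
`N` fixed (`exists_level_mean_norm_sq_le`). Integrating over the position of the window and using
the definition of the law of the bi-infinite words by frequencies, the expected energy per tile
under that law is small as well (`eventually_integral_headEnergy_le`).

*Almost sure statement.* The law is invariant under the shift, and the maximal ergodic inequality
turns small expectations into averages along almost every bi-infinite word that are small uniformly
in the size of the range (`ae_smallEnergies`); ergodicity is not needed. Finally, with
`φ = |𝓕 g|²`, which is a constant at `k` independent of `R`, a diffraction measure `ν = 𝓕 γ`
satisfies `φ(k) ν{k} ≤ ∫ φ dν = ∫ 𝓕 φ dγ`. The function `𝓕 φ` is the autocorrelation of `g`, of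
compact support, so that the last integral is a limit of normalised energies of patches
(`SmallEnergies.measure_singleton_eq_zero`).
-/

noncomputable section

namespace RNMS

/-! ### Expectations over finitely supported laws -/

section Mean

variable {α β E F : Type} [NormedAddCommGroup E] [NormedSpace ℝ E]
  [NormedAddCommGroup F] [NormedSpace ℝ F]

/-- The expectation of `f` under the discrete law `q`. It is used for laws of finite support only,
so that summability never is an issue. -/
def mean (q : PMF α) (f : α → E) : E := ∑' w, (q w).toReal • f w

theorem mean_eq_sum {q : PMF α} (hq : q.support.Finite) (f : α → E) :
    mean q f = ∑ w ∈ hq.toFinset, (q w).toReal • f w := by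
  refine tsum_eq_sum fun w hw => ?_
  have : q w = 0 := by simpa [PMF.mem_support_iff] using hw
  simp [this]

theorem sum_toReal {q : PMF α} (hq : q.support.Finite) :
    ∑ w ∈ hq.toFinset, (q w).toReal = 1 := by
  have h : ∑' w, q w = ∑ w ∈ hq.toFinset, q w :=
    tsum_eq_sum fun w hw => by simpa [PMF.mem_support_iff] using hw
  rw [← ENNReal.toReal_sum fun w _ => q.apply_ne_top w, ← h, q.tsum_coe, ENNReal.toReal_one]

theorem mean_congr {q : PMF α} {f g : α → E} (h : ∀ w ∈ q.support, f w = g w) :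
    mean q f = mean q g := by
  refine tsum_congr fun w => ?_
  by_cases hw : w ∈ q.support
  · rw [h w hw]
  · have : q w = 0 := by simpa [PMF.mem_support_iff] using hw
    simp [this]

theorem mean_const {q : PMF α} (hq : q.support.Finite) (c : E) : mean q (fun _ => c) = c := by
  rw [mean_eq_sum hq, ← Finset.sum_smul, sum_toReal hq, one_smul]

theorem mean_add {q : PMF α} (hq : q.support.Finite) (f g : α → E) :
    mean q (fun w => f w + g w) = mean q f + mean q g := by
  simp only [mean_eq_sum hq, smul_add, Finset.sum_add_distrib]

theorem mean_clm {q : PMF α} (hq : q.support.Finite) (T : E →L[ℝ] F) (f : α → E) :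
    mean q (fun w => T (f w)) = T (mean q f) := by
  simp only [mean_eq_sum hq, map_sum, map_smul]

theorem mean_const_mul {q : PMF α} (hq : q.support.Finite) (c : ℂ) (f : α → ℂ) :
    mean q (fun w => c * f w) = c * mean q f := by
  simp only [mean_eq_sum hq, Finset.mul_sum, mul_smul_comm]

theorem mean_const_mul_real {q : PMF α} (hq : q.support.Finite) (c : ℝ) (f : α → ℝ) :
    mean q (fun w => c * f w) = c * mean q f := by
  simp only [mean_eq_sum hq, Finset.mul_sum, mul_smul_comm]

theorem mean_finset_sum {ι : Type} {q : PMF α} (hq : q.support.Finite) (s : Finset ι)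
    (f : ι → α → E) : mean q (fun w => ∑ i ∈ s, f i w) = ∑ i ∈ s, mean q (f i) := by
  simp only [mean_eq_sum hq, Finset.smul_sum]
  exact Finset.sum_comm

theorem mean_mono {q : PMF α} (hq : q.support.Finite) {f g : α → ℝ}
    (h : ∀ w ∈ q.support, f w ≤ g w) : mean q f ≤ mean q g := by
  simp only [mean_eq_sum hq]
  refine Finset.sum_le_sum fun w hw => ?_
  exact smul_le_smul_of_nonneg_left (h w (hq.mem_toFinset.1 hw)) ENNReal.toReal_nonneg

theorem norm_mean_le {q : PMF α} (hq : q.support.Finite) {f : α → E} {C : ℝ}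
    (h : ∀ w ∈ q.support, ‖f w‖ ≤ C) : ‖mean q f‖ ≤ C := by
  rw [mean_eq_sum hq]
  calc _ ≤ ∑ w ∈ hq.toFinset, (q w).toReal * C := by
        refine norm_sum_le_of_le _ fun w hw => ?_
        rw [norm_smul, Real.norm_of_nonneg ENNReal.toReal_nonneg]
        exact mul_le_mul_of_nonneg_left (h w (hq.mem_toFinset.1 hw)) ENNReal.toReal_nonneg
    _ = C := by rw [← Finset.sum_mul, sum_toReal hq, one_mul]

theorem mean_pure (x : α) (f : α → E) : mean (PMF.pure x) f = f x := by
  rw [mean, tsum_eq_single x]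
  · simp
  · intro y hy
    simp [PMF.pure_apply, hy]

theorem support_bind_finite {q : PMF α} (hq : q.support.Finite) {r : α → PMF β}
    (hr : ∀ x, (r x).support.Finite) : (q.bind r).support.Finite := by
  rw [PMF.support_bind]
  exact hq.biUnion fun x _ => hr x

theorem support_map_finite {q : PMF α} (hq : q.support.Finite) (f : α → β) :
    (q.map f).support.Finite := by
  rw [PMF.support_map]
  exact hq.image f

theorem mean_bind {q : PMF α} (hq : q.support.Finite) {r : α → PMF β}
    (hr : ∀ x, (r x).support.Finite) (f : β → E) :
    mean (q.bind r) f = mean q fun x => mean (r x) f := by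
  have hfin := support_bind_finite hq hr
  have key : ∀ x ∈ hq.toFinset,
      mean (r x) f = ∑ y ∈ hfin.toFinset, (r x y).toReal • f y := by
    intro x hx
    refine tsum_eq_sum fun y hy => ?_
    have h0 : r x y = 0 := by
      by_contra hne
      refine hy (hfin.mem_toFinset.2 ?_)
      rw [PMF.mem_support_bind_iff]
      exact ⟨x, hq.mem_toFinset.1 hx, (PMF.mem_support_iff _ _).2 hne⟩
    simp [h0]
  have hsum : mean q (fun x => mean (r x) f) = ∑ x ∈ hq.toFinset, ∑ y ∈ hfin.toFinset,
      (q x).toReal • (r x y).toReal • f y := by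
    rw [mean_eq_sum hq]
    exact Finset.sum_congr rfl fun x hx => by rw [key x hx, Finset.smul_sum]
  rw [mean_eq_sum hfin, hsum, Finset.sum_comm]
  refine Finset.sum_congr rfl fun y _ => ?_
  have : (q.bind r) y = ∑ x ∈ hq.toFinset, q x * r x y := by
    rw [PMF.bind_apply]
    refine tsum_eq_sum fun x hx => ?_
    have : q x = 0 := by simpa [PMF.mem_support_iff] using hx
    simp [this]
  rw [this, ENNReal.toReal_sum fun x _ => ENNReal.mul_ne_top (q.apply_ne_top x)
    ((r x).apply_ne_top y), Finset.sum_smul]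
  simp only [ENNReal.toReal_mul, mul_smul]

theorem mean_map {q : PMF α} (hq : q.support.Finite) (g : α → β) (f : β → E) :
    mean (q.map g) f = mean q fun x => f (g x) := by
  rw [← PMF.bind_pure_comp, mean_bind hq fun x => by simp]
  simp [mean_pure]

theorem mean_integral {q : PMF α} (hq : q.support.Finite) (f : α → ℝ → E)
    (hf : ∀ w, Integrable (f w)) :
    ∫ t, mean q (fun w => f w t) = mean q fun w => ∫ t, f w t := by
  simp only [mean_eq_sum hq]
  rw [integral_finsetSum (f := fun w t => (q w).toReal • f w t) _
    fun w _ => (hf w).smul (q w).toReal]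
  simp only [integral_smul]

end Mean

/-! ### Iterated random substitutions -/

section Substitution

variable {α : Type} {E : Type} [NormedAddCommGroup E] [NormedSpace ℝ E]

namespace RandomSubstitution

theorem onWord_cons (ρ : RandomSubstitution α) (x : α) (w : List α) :
    ρ.onWord (x :: w) = (ρ x).bind fun u => (ρ.onWord w).map fun v => u ++ v := rfl

theorem onWord_append (ρ : RandomSubstitution α) (u v : List α) :
    ρ.onWord (u ++ v) = (ρ.onWord u).bind fun u' => (ρ.onWord v).map fun v' => u' ++ v' := by
  induction u with
  | nil =>
    simp only [List.nil_append, onWord, PMF.pure_bind]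
    exact (PMF.map_id _).symm
  | cons x u ih =>
    rw [List.cons_append, onWord_cons, onWord_cons, ih]
    simp [PMF.bind_bind, PMF.map_bind, PMF.bind_map, PMF.map_comp, Function.comp_def]

theorem onWord_singleton (ρ : RandomSubstitution α) (x : α) : ρ.onWord [x] = ρ x := by
  simp [onWord, PMF.pure_map, PMF.bind_pure]

theorem onWord_bind (σ ρ : RandomSubstitution α) (u : List α) :
    (σ.onWord u).bind ρ.onWord
      = RandomSubstitution.onWord (fun c => (σ c).bind ρ.onWord) u := by
  induction u with
  | nil => simp [onWord, PMF.pure_bind]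
  | cons x u ih =>
    rw [onWord_cons, onWord_cons, ← ih]
    simp only [PMF.bind_bind, PMF.map_bind, PMF.bind_map, Function.comp_def, onWord_append]
    congr 1
    funext u'
    rw [PMF.bind_comm]

theorem iterate_add (ρ : RandomSubstitution α) (x : α) (n N : ℕ) :
    ρ.iterate x (n + N)
      = (ρ.iterate x n).bind (RandomSubstitution.onWord fun c => ρ.iterate c N) := by
  induction N with
  | zero =>
    have h : ∀ u : List α,
        RandomSubstitution.onWord (fun c => ρ.iterate c 0) u = PMF.pure u := by
      intro u
      induction u with
      | nil => rfl
      | cons y u ih => rw [onWord_cons, ih]; simp [iterate, PMF.pure_bind, PMF.pure_map]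
    rw [show RandomSubstitution.onWord (fun c => ρ.iterate c 0) = PMF.pure from funext h]
    simp [PMF.bind_pure]
  | succ N ih =>
    rw [← add_assoc, iterate, ih, PMF.bind_bind]
    congr 1
    funext u
    rw [onWord_bind]
    rfl

theorem iterate_one (ρ : RandomSubstitution α) (x : α) : ρ.iterate x 1 = ρ x := by
  rw [iterate, iterate, PMF.pure_bind, onWord_singleton]

theorem iterate_succ' (ρ : RandomSubstitution α) (x : α) (n : ℕ) :
    ρ.iterate x (n + 1)
      = (ρ x).bind (RandomSubstitution.onWord fun c => ρ.iterate c n) := by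
  rw [add_comm, iterate_add, iterate_one]

theorem support_onWord_finite {ρ : RandomSubstitution α} (hρ : ∀ c, (ρ c).support.Finite)
    (u : List α) : (ρ.onWord u).support.Finite := by
  induction u with
  | nil => simp [onWord]
  | cons x u ih =>
    exact support_bind_finite (hρ x) fun v => support_map_finite ih _

theorem support_iterate_finite {ρ : RandomSubstitution α} (hρ : ∀ c, (ρ c).support.Finite)
    (x : α) (n : ℕ) : (ρ.iterate x n).support.Finite := by
  induction n with
  | zero => simp [iterate]
  | succ n ih => exact support_bind_finite ih fun u => support_onWord_finite hρ u

/-- The independence of the images of the letters, as a Fubini rule. -/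
theorem mean_onWord_cons {ρ : RandomSubstitution α} (hρ : ∀ c, (ρ c).support.Finite)
    (x : α) (u : List α) (f : List α → E) :
    mean (ρ.onWord (x :: u)) f = mean (ρ x) fun v => mean (ρ.onWord u) fun w => f (v ++ w) := by
  rw [onWord_cons, mean_bind (hρ x) fun v => support_map_finite (support_onWord_finite hρ u) _]
  congr 1
  funext v
  exact mean_map (support_onWord_finite hρ u) _ _

end RandomSubstitution

end Substitution

/-! ### The noble means inflation and its patches -/

theorem lam_sq (m : ℕ) : lam m ^ 2 = m * lam m + 1 := by
  have h : √((m : ℝ) ^ 2 + 4) ^ 2 = (m : ℝ) ^ 2 + 4 := Real.sq_sqrt (by positivity)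
  rw [lam]
  linarith

theorem one_lt_lam {m : ℕ} (hm : 1 ≤ m) : 1 < lam m := by
  have h1 : (1 : ℝ) ≤ m := by exact_mod_cast hm
  have h2 : (2 : ℝ) < √((m : ℝ) ^ 2 + 4) := Real.lt_sqrt_of_sq_lt (by nlinarith)
  rw [lam]
  linarith

theorem lam_pos {m : ℕ} (hm : 1 ≤ m) : 0 < lam m := one_pos.trans (one_lt_lam hm)

theorem one_le_tileLength {m : ℕ} (hm : 1 ≤ m) (c : Letter) : 1 ≤ tileLength m c := by
  cases c
  · exact (one_lt_lam hm).le
  · exact le_rfl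

theorem tileLength_le {m : ℕ} (hm : 1 ≤ m) (c : Letter) : tileLength m c ≤ lam m := by
  cases c
  · exact le_rfl
  · exact (one_lt_lam hm).le

/-- The length of the patch given by a finite word. -/
def patchLength (m : ℕ) (w : List Letter) : ℝ := (w.map (tileLength m)).sum

@[simp] theorem patchLength_nil (m : ℕ) : patchLength m [] = 0 := rfl

@[simp] theorem patchLength_cons (m : ℕ) (c : Letter) (w : List Letter) :
    patchLength m (c :: w) = tileLength m c + patchLength m w := by simp [patchLength]

theorem patchLength_append (m : ℕ) (u v : List Letter) :
    patchLength m (u ++ v) = patchLength m u + patchLength m v := by simp [patchLength]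

theorem length_le_patchLength {m : ℕ} (hm : 1 ≤ m) (w : List Letter) :
    (w.length : ℝ) ≤ patchLength m w := by
  induction w with
  | nil => simp
  | cons c w ih =>
    have := one_le_tileLength hm c
    push_cast [List.length_cons, patchLength_cons]
    linarith

theorem patchLength_le {m : ℕ} (hm : 1 ≤ m) (w : List Letter) :
    patchLength m w ≤ lam m * w.length := by
  induction w with
  | nil => simp
  | cons c w ih =>
    have := tileLength_le hm c
    push_cast [List.length_cons, patchLength_cons]
    linarith

theorem patchLength_nonneg {m : ℕ} (hm : 1 ≤ m) (w : List Letter) : 0 ≤ patchLength m w :=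
  (Nat.cast_nonneg _).trans (length_le_patchLength hm w)

theorem nobleMeans_a (m : ℕ) (p : PMF (Fin (m + 1))) :
    nobleMeans m p Letter.a = p.map fun i : Fin (m + 1) =>
      List.replicate (i : ℕ) Letter.a ++ Letter.b :: List.replicate (m - (i : ℕ)) Letter.a := by
  change PMF.map _ (p.bind fun i => PMF.pure (i : ℕ)) = _
  rw [PMF.map_bind]
  simp only [PMF.pure_map]
  rfl

theorem support_nobleMeans_finite (m : ℕ) (p : PMF (Fin (m + 1))) (c : Letter) :
    (nobleMeans m p c).support.Finite := by
  cases c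
  · rw [nobleMeans_a]
    exact support_map_finite (Set.toFinite _) _
  · simp [nobleMeans]

theorem patchLength_replicate (m n : ℕ) (c : Letter) :
    patchLength m (List.replicate n c) = n * tileLength m c := by
  simp [patchLength]

theorem patchLength_of_mem_support (m : ℕ) (p : PMF (Fin (m + 1))) {c : Letter}
    {w : List Letter} (hw : w ∈ (nobleMeans m p c).support) :
    patchLength m w = lam m * tileLength m c := by
  cases c
  · rw [nobleMeans_a, PMF.mem_support_map_iff] at hw
    obtain ⟨i, -, rfl⟩ := hw
    have hi : (i : ℕ) ≤ m := Nat.lt_succ_iff.1 i.2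
    have := lam_sq m
    rw [patchLength_append, patchLength_cons, patchLength_replicate, patchLength_replicate,
      Nat.cast_sub hi]
    simp only [tileLength]
    linarith
  · have : w = [Letter.a] := by simpa [nobleMeans] using hw
    subst this
    simp [tileLength]

theorem patchLength_of_mem_support_onWord {m : ℕ} {L : ℝ} {ρ : RandomSubstitution Letter}
    (hρ : ∀ c, ∀ w ∈ (ρ c).support, patchLength m w = L * tileLength m c)
    {u w : List Letter} (hw : w ∈ (ρ.onWord u).support) :
    patchLength m w = L * patchLength m u := by
  induction u generalizing w with
  | nil =>
    have : w = [] := by simpa [RandomSubstitution.onWord] using hw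
    simp [this]
  | cons c u ih =>
    rw [RandomSubstitution.onWord_cons, PMF.mem_support_bind_iff] at hw
    obtain ⟨v, hv, hw⟩ := hw
    rw [PMF.mem_support_map_iff] at hw
    obtain ⟨w', hw', rfl⟩ := hw
    rw [patchLength_append, patchLength_cons, hρ c v hv, ih hw', mul_add]

/-- All realisations of an inflation word have the same geometric length. -/
theorem patchLength_of_mem_support_iterate (m : ℕ) (p : PMF (Fin (m + 1))) {c : Letter} {n : ℕ}
    {w : List Letter} (hw : w ∈ ((nobleMeans m p).iterate c n).support) :
    patchLength m w = lam m ^ n * tileLength m c := by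
  induction n generalizing w with
  | zero =>
    have : w = [c] := by simpa [RandomSubstitution.iterate] using hw
    simp [this]
  | succ n ih =>
    rw [RandomSubstitution.iterate, PMF.mem_support_bind_iff] at hw
    obtain ⟨u, hu, hw⟩ := hw
    rw [patchLength_of_mem_support_onWord
      (fun c w hw => patchLength_of_mem_support m p hw) hw, ih hu]
    ring

theorem patchPoint_zero (m : ℕ) (w : List Letter) : patchPoint m w 0 = 0 := by
  simp [patchPoint]

theorem patchPoint_cons_succ (m : ℕ) (c : Letter) (w : List Letter) (j : ℕ) :
    patchPoint m (c :: w) (j + 1) = tileLength m c + patchPoint m w j := by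
  simp [patchPoint]

/-- The sum over a patch of the values of a function at the left endpoints of the tiles, for the
patch that starts at `s`. -/
def patchSum (m : ℕ) (f : ℝ → ℂ) (s : ℝ) (w : List Letter) : ℂ :=
  ∑ j ∈ Finset.range w.length, f (s + patchPoint m w j)

@[simp] theorem patchSum_nil (m : ℕ) (f : ℝ → ℂ) (s : ℝ) : patchSum m f s [] = 0 := by
  simp [patchSum]

theorem patchSum_cons (m : ℕ) (f : ℝ → ℂ) (s : ℝ) (c : Letter) (w : List Letter) :
    patchSum m f s (c :: w) = f s + patchSum m f (s + tileLength m c) w := by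
  rw [patchSum, List.length_cons, Finset.sum_range_succ', patchPoint_zero, add_comm,
    add_zero, patchSum]
  simp only [patchPoint_cons_succ, add_assoc]

theorem patchSum_append (m : ℕ) (f : ℝ → ℂ) (s : ℝ) (u v : List Letter) :
    patchSum m f s (u ++ v) = patchSum m f s u + patchSum m f (s + patchLength m u) v := by
  induction u generalizing s with
  | nil => simp
  | cons c u ih =>
    rw [List.cons_append, patchSum_cons, patchSum_cons, ih, patchLength_cons]
    simp only [add_assoc]

/-- The plane wave `x ↦ exp(-2πikx)`. -/
def wave (k x : ℝ) : ℂ := Complex.exp (-2 * Real.pi * Complex.I * k * x)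

theorem wave_add (k x y : ℝ) : wave k (x + y) = wave k x * wave k y := by
  rw [wave, wave, wave, ← Complex.exp_add]
  push_cast
  ring_nf

theorem norm_wave (k x : ℝ) : ‖wave k x‖ = 1 := by
  rw [wave, show (-2 * Real.pi * Complex.I * k * x : ℂ) = ((-2 * Real.pi * k * x : ℝ) : ℂ)
    * Complex.I by push_cast; ring, Complex.norm_exp_ofReal_mul_I]

theorem patchSum_wave (m : ℕ) (k s : ℝ) (w : List Letter) :
    patchSum m (wave k) s w = wave k s * patchAmplitude m k w := by
  simp only [patchSum, patchAmplitude, Finset.mul_sum, wave_add]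
  rfl

theorem patchAmplitude_append (m : ℕ) (k : ℝ) (u v : List Letter) :
    patchAmplitude m k (u ++ v)
      = patchAmplitude m k u + wave k (patchLength m u) * patchAmplitude m k v := by
  have h := patchSum_append m (wave k) 0 u v
  simpa [patchSum_wave, wave] using h

/-- The mean amplitude of the level-`n` inflation words of the letter `c`. -/
def letterAmplitude (m : ℕ) (p : PMF (Fin (m + 1))) (k : ℝ) (c : Letter) (n : ℕ) : ℂ :=
  mean ((nobleMeans m p).iterate c n) (patchAmplitude m k)

theorem meanAmplitude_eq (m : ℕ) (p : PMF (Fin (m + 1))) (k : ℝ) (n : ℕ) :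
    meanAmplitude m p k n = letterAmplitude m p k Letter.b n := rfl

/-! ### Wave numbers whose phases converge -/

theorem abs_sub_round_le_norm_wave_sub_one (k x : ℝ) :
    |k * x - round (k * x)| ≤ ‖wave k x - 1‖ := by
  set e : ℝ := k * x - round (k * x) with he
  have h1 : wave k x = Complex.exp (Complex.I * ((-(2 * Real.pi * (k * x)) : ℝ) : ℂ)) := by
    rw [wave]
    push_cast
    ring_nf
  have h2 : |e| ≤ 1 / 2 := abs_sub_round _
  have h3 : |Real.sin (Real.pi * (k * x))| = |Real.sin (Real.pi * e)| := by
    rw [show Real.pi * e = Real.pi * (k * x) - (round (k * x) : ℤ) * Real.pi by rw [he]; ring,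
      Real.sin_sub_int_mul_pi, abs_mul]
    rcases Int.even_or_odd (round (k * x)) with h | h <;> simp [h.neg_one_zpow]
  have h4 : 2 / Real.pi * |Real.pi * e| ≤ |Real.sin (Real.pi * e)| := by
    refine Real.mul_abs_le_abs_sin ?_
    rw [abs_mul, abs_of_pos Real.pi_pos]
    nlinarith [Real.pi_pos]
  have h5 : 2 / Real.pi * |Real.pi * e| = 2 * |e| := by
    rw [abs_mul, abs_of_pos Real.pi_pos]
    field_simp
  rw [h1, Complex.norm_exp_I_mul_ofReal_sub_one,
    show -(2 * Real.pi * (k * x)) / 2 = -(Real.pi * (k * x)) by ring, Real.sin_neg, norm_mul,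
    norm_neg, Real.norm_eq_abs (Real.sin _), h3]
  norm_num
  nlinarith [abs_nonneg e, abs_nonneg (Real.sin (Real.pi * e))]

/-- The Pisot property of `λₘ`: if the phases of `k λₘⁿ` converge to `0`, then `k` belongs to the
Fourier module. The nearest integers `Nₙ` to `k λₘⁿ` eventually satisfy the recursion of the powers
of `λₘ`, and then `Nₙ₊₁ - (m - λₘ) Nₙ` equals `k λₘⁿ √(m² + 4)`. -/
theorem mem_fourierModule_of_tendsto {m : ℕ} (hm : 1 ≤ m) {k : ℝ}
    (h : Tendsto (fun n : ℕ => wave k (lam m ^ n)) atTop (𝓝 1)) : k ∈ fourierModule m := by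
  set l := lam m with hl
  have hl1 : 1 < l := one_lt_lam hm
  have hl2 : l ^ 2 = m * l + 1 := lam_sq m
  set N : ℕ → ℤ := fun n => round (k * l ^ n) with hN
  set e : ℕ → ℝ := fun n => k * l ^ n - N n with he
  have he0 : Tendsto e atTop (𝓝 0) := by
    have h0 : Tendsto (fun n : ℕ => ‖wave k (l ^ n) - 1‖) atTop (𝓝 0) :=
      tendsto_iff_norm_sub_tendsto_zero.1 h
    exact squeeze_zero_norm (fun n => abs_sub_round_le_norm_wave_sub_one k (l ^ n)) h0
  have he1 : Tendsto (fun n => e (n + 1)) atTop (𝓝 0) := he0.comp (tendsto_add_atTop_nat 1)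
  have he2 : Tendsto (fun n => e (n + 2)) atTop (𝓝 0) := he0.comp (tendsto_add_atTop_nat 2)
  have hrec : ∀ n, e (n + 2) - m * e (n + 1) - e n
      = -((N (n + 2) - m * N (n + 1) - N n : ℤ) : ℝ) := by
    intro n
    simp only [he]
    push_cast
    linear_combination k * l ^ n * hl2
  have hlim : Tendsto (fun n => e (n + 2) - m * e (n + 1) - e n) atTop (𝓝 0) := by
    simpa using (he2.sub (he1.const_mul (m : ℝ))).sub he0
  have hev : ∀ᶠ n in atTop, e (n + 2) - m * e (n + 1) - e n = 0 := by
    filter_upwards [hlim.eventually (Metric.ball_mem_nhds 0 one_pos)] with n hn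
    rw [Real.dist_eq, sub_zero, hrec, abs_neg, ← Int.cast_abs] at hn
    have : |N (n + 2) - m * N (n + 1) - N n| < 1 := by exact_mod_cast hn
    rw [hrec, Int.abs_lt_one_iff.1 this]
    simp
  obtain ⟨n₀, hn₀⟩ := eventually_atTop.1 hev
  -- The component of the error along the expanding direction grows like `λⁿ`, so it vanishes.
  set d : ℕ → ℝ := fun n => e (n + 1) - (m - l) * e n with hd
  have hd0 : Tendsto d atTop (𝓝 0) := by simpa using he1.sub (he0.const_mul ((m : ℝ) - l))
  have hdrec : ∀ n, d (n₀ + n) = l ^ n * d n₀ := by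
    intro n
    induction n with
    | zero => simp
    | succ n ih =>
      have h1 := hn₀ (n₀ + n) (Nat.le_add_right _ _)
      have h2 : d (n₀ + (n + 1)) = l * d (n₀ + n) := by
        simp only [hd]
        rw [show n₀ + (n + 1) + 1 = n₀ + n + 2 by ring, show n₀ + (n + 1) = n₀ + n + 1 by ring]
        linear_combination h1 - e (n₀ + n) * hl2
      rw [h2, ih]
      ring
  have hdz : d n₀ = 0 := by
    by_contra hne
    have h1 : Tendsto (fun n => d (n₀ + n)) atTop (𝓝 0) := by
      simp only [add_comm n₀]
      exact hd0.comp (tendsto_add_atTop_nat n₀)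
    have h2 : ∀ᶠ n in atTop, |d (n₀ + n)| < |d n₀| := by
      filter_upwards [h1.eventually (Metric.ball_mem_nhds 0 (abs_pos.2 hne))] with n hn
      simpa [Real.dist_eq] using hn
    obtain ⟨n, hn⟩ := h2.exists
    rw [hdrec, abs_mul, abs_of_pos (by positivity)] at hn
    nlinarith [abs_nonneg (d n₀), one_le_pow₀ hl1.le (n := n)]
  have hsq : √((m : ℝ) ^ 2 + 4) = 2 * l - m := by rw [hl, lam]; ring
  have hsq0 : √((m : ℝ) ^ 2 + 4) ≠ 0 := by positivity
  have hlmem : l ∈ Algebra.adjoin ℤ {l} := Algebra.self_mem_adjoin_singleton ℤ l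
  have hint : ∀ z : ℤ, (z : ℝ) ∈ Algebra.adjoin ℤ {l} := fun z => by
    simp
  have hm' : (m : ℝ) ∈ Algebra.adjoin ℤ {l} := by exact_mod_cast hint m
  refine ⟨(l - m) ^ n₀ * (N (n₀ + 1) - (m - l) * N n₀), ?_, ?_⟩
  · exact mul_mem (pow_mem (sub_mem hlmem hm') _)
      (sub_mem (hint _) (mul_mem (sub_mem hm' hlmem) (hint _)))
  · rw [eq_div_iff hsq0, hsq]
    have h1 : (N (n₀ + 1) : ℝ) - (m - l) * N n₀ = k * l ^ n₀ * (2 * l - m) := by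
      simp only [hd, he] at hdz
      linear_combination -hdz
    have h2 : (l - m) ^ n₀ * l ^ n₀ = 1 := by
      rw [← mul_pow, show (l - m) * l = 1 by linear_combination hl2, one_pow]
    rw [h1]
    linear_combination -(k * (2 * l - m)) * h2

/-! ### The recursion for the mean amplitudes -/

/-- The phases `exp(-2πikλₘⁿ)`. -/
def phase (m : ℕ) (k : ℝ) (n : ℕ) : ℂ := wave k (lam m ^ n)

theorem norm_phase (m : ℕ) (k : ℝ) (n : ℕ) : ‖phase m k n‖ = 1 := norm_wave _ _

theorem support_iterate_nobleMeans_finite (m : ℕ) (p : PMF (Fin (m + 1))) (c : Letter) (n : ℕ) :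
    ((nobleMeans m p).iterate c n).support.Finite :=
  RandomSubstitution.support_iterate_finite (support_nobleMeans_finite m p) c n

section Recursion

variable (m : ℕ) (p : PMF (Fin (m + 1))) (k : ℝ) (n : ℕ)

theorem mean_patchAmplitude_cons (c : Letter) (u : List Letter) :
    mean (RandomSubstitution.onWord (fun c => (nobleMeans m p).iterate c n) (c :: u))
        (patchAmplitude m k)
      = letterAmplitude m p k c n + wave k (lam m ^ n * tileLength m c) *
        mean (RandomSubstitution.onWord (fun c => (nobleMeans m p).iterate c n) u)
          (patchAmplitude m k) := by
  have hfin := fun c => support_iterate_nobleMeans_finite m p c n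
  have hfin' := RandomSubstitution.support_onWord_finite hfin u
  rw [RandomSubstitution.mean_onWord_cons hfin]
  have : ∀ v ∈ ((nobleMeans m p).iterate c n).support,
      mean (RandomSubstitution.onWord (fun c => (nobleMeans m p).iterate c n) u)
        (fun w => patchAmplitude m k (v ++ w))
      = patchAmplitude m k v + wave k (lam m ^ n * tileLength m c) *
        mean (RandomSubstitution.onWord (fun c => (nobleMeans m p).iterate c n) u)
          (patchAmplitude m k) := by
    intro v hv
    simp only [patchAmplitude_append, patchLength_of_mem_support_iterate m p hv]
    rw [mean_add hfin', mean_const hfin', mean_const_mul hfin']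
  rw [mean_congr this, mean_add (hfin c), mean_const (hfin c)]
  rfl

theorem mean_patchAmplitude_replicate (j : ℕ) (u : List Letter) :
    mean (RandomSubstitution.onWord (fun c => (nobleMeans m p).iterate c n)
        (List.replicate j Letter.a ++ u)) (patchAmplitude m k)
      = (∑ l ∈ Finset.range j, phase m k (n + 1) ^ l) * letterAmplitude m p k Letter.a n
        + phase m k (n + 1) ^ j *
        mean (RandomSubstitution.onWord (fun c => (nobleMeans m p).iterate c n) u)
          (patchAmplitude m k) := by
  induction j with
  | zero => simp
  | succ j ih =>
    rw [List.replicate_succ, List.cons_append, mean_patchAmplitude_cons, ih,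
      Finset.sum_range_succ', show lam m ^ n * tileLength m Letter.a = lam m ^ (n + 1) from
        (pow_succ _ _).symm, ← phase]
    simp only [pow_succ, ← Finset.sum_mul]
    ring

theorem letterAmplitude_b_succ :
    letterAmplitude m p k Letter.b (n + 1) = letterAmplitude m p k Letter.a n := by
  rw [letterAmplitude, RandomSubstitution.iterate_succ', nobleMeans, PMF.pure_bind,
    RandomSubstitution.onWord_singleton]
  rfl

/-- The amplitude of the level-`n` inflation words of `a`, relative to their length. -/
def relAmplitude : ℂ := letterAmplitude m p k Letter.a n / (lam m : ℂ) ^ n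

/-- The contribution of the `l`-th supertile to the relative amplitude of the word
`aⁱ b aᵐ⁻ⁱ` of supertiles; the value `l = m` stands for the supertile of type `b`. -/
def summand (i l : ℕ) : ℂ :=
  if l < m then
    (if l < i then phase m k (n + 2) ^ l else phase m k (n + 1) * phase m k (n + 2) ^ l)
      * relAmplitude m p k (n + 1)
  else phase m k (n + 2) ^ i * relAmplitude m p k n

/-- The weight of the `l`-th supertile of an inflated `a`, proportional to its length. -/
def weight (l : ℕ) : ℝ := if l < m then (lam m)⁻¹ else (lam m ^ 2)⁻¹

variable {m}

theorem weight_pos (hm : 1 ≤ m) (l : ℕ) : 0 < weight m l := by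
  have := lam_pos hm
  rw [weight]
  split_ifs <;> positivity

theorem sum_weight (hm : 1 ≤ m) : ∑ l ∈ Finset.range (m + 1), weight m l = 1 := by
  have h0 := lam_pos hm
  have h : ∀ l ∈ Finset.range m, weight m l = (lam m)⁻¹ := fun l hl =>
    if_pos (Finset.mem_range.1 hl)
  rw [Finset.sum_range_succ, Finset.sum_congr rfl h, weight, if_neg (lt_irrefl m)]
  have := lam_sq m
  simp only [Finset.sum_const, Finset.card_range, nsmul_eq_mul]
  field_simp
  linarith

theorem relAmplitude_add_two (hm : 1 ≤ m) :
    relAmplitude m p k (n + 2) = ∑ x ∈ Finset.univ ×ˢ Finset.range (m + 1),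
      ((p x.1).toReal * weight m x.2) • summand m p k n x.1 x.2 := by
  have h0 : (lam m : ℂ) ≠ 0 := by exact_mod_cast (lam_pos hm).ne'
  have hfin := fun c => support_iterate_nobleMeans_finite m p c (n + 1)
  have hmean : ∀ f : Fin (m + 1) → ℂ, mean p f = ∑ i, (p i).toReal • f i := fun f =>
    tsum_fintype _
  rw [Finset.sum_product, relAmplitude, letterAmplitude, RandomSubstitution.iterate_succ',
    mean_bind (support_nobleMeans_finite m p _)
      fun u => RandomSubstitution.support_onWord_finite hfin u, nobleMeans_a,
    mean_map (Set.toFinite _), hmean, Finset.sum_div]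
  refine Finset.sum_congr rfl fun i _ => ?_
  have hi : (i : ℕ) ≤ m := Nat.lt_succ_iff.1 i.2
  simp only [mul_smul, ← Finset.smul_sum]
  rw [smul_div_assoc]
  congr 1
  have h1 := mean_patchAmplitude_replicate m p k (n + 1) (m - i) []
  have h2 : mean (RandomSubstitution.onWord (fun c => (nobleMeans m p).iterate c (n + 1)) [])
      (patchAmplitude m k) = 0 := by
    rw [RandomSubstitution.onWord, mean_pure]
    simp [patchAmplitude]
  rw [List.append_nil, h2, mul_zero, add_zero] at h1
  rw [mean_patchAmplitude_replicate, mean_patchAmplitude_cons, h1, letterAmplitude_b_succ,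
    show lam m ^ (n + 1) * tileLength m Letter.b = lam m ^ (n + 1) from mul_one _, ← phase]
  have h3 : ∀ l ∈ Finset.range i, weight m l • summand m p k n i l
      = phase m k (n + 2) ^ l * ((lam m : ℂ)⁻¹ * relAmplitude m p k (n + 1)) := by
    intro l hl
    have hl := Finset.mem_range.1 hl
    rw [weight, summand, if_pos (by omega), if_pos (by omega), if_pos hl, Complex.real_smul]
    push_cast
    ring
  have h4 : ∀ l ∈ Finset.range (m - i), weight m (i + l) • summand m p k n i (i + l)
      = phase m k (n + 2) ^ l * (phase m k (n + 1) * phase m k (n + 2) ^ (i : ℕ) *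
        ((lam m : ℂ)⁻¹ * relAmplitude m p k (n + 1))) := by
    intro l hl
    have hl := Finset.mem_range.1 hl
    rw [weight, summand, if_pos (by omega), if_pos (by omega), if_neg (by omega),
      Complex.real_smul, pow_add]
    push_cast
    ring
  have h5 : weight m m • summand m p k n i m
      = ((lam m : ℂ) ^ 2)⁻¹ * (phase m k (n + 2) ^ (i : ℕ) * relAmplitude m p k n) := by
    rw [weight, summand, if_neg (lt_irrefl m), if_neg (lt_irrefl m), Complex.real_smul]
    push_cast
    ring
  have h6 : ∀ f : ℕ → ℂ, ∑ l ∈ Finset.range m, f l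
      = ∑ l ∈ Finset.range i, f l + ∑ l ∈ Finset.range (m - i), f (i + l) := fun f => by
    rw [← Finset.sum_range_add, Nat.add_sub_cancel' hi]
  rw [Finset.sum_range_succ, h5, h6]
  rw [Finset.sum_congr rfl h3, Finset.sum_congr rfl h4, ← Finset.sum_mul, ← Finset.sum_mul]
  simp only [relAmplitude]
  field_simp
  ring

theorem norm_summand_le (i l : ℕ) : ‖summand m p k n i l‖
    ≤ if l < m then ‖relAmplitude m p k (n + 1)‖ else ‖relAmplitude m p k n‖ := by
  rw [summand]
  split_ifs <;> simp [norm_phase]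

end Recursion

/-! ### Decay of the mean amplitudes -/

/-- The variance identity for convex combinations: if a convex combination of vectors of a ball
comes close to its boundary, then so does every vector of positive weight, at the same place. -/
theorem weight_mul_norm_sub_sq_le {ι : Type*} (s : Finset ι) (a : ι → ℝ) (T : ι → ℂ) {r : ℝ}
    (ha : ∀ i ∈ s, 0 ≤ a i) (ha1 : ∑ i ∈ s, a i = 1) (hT : ∀ i ∈ s, ‖T i‖ ≤ r) {j : ι}
    (hj : j ∈ s) :
    a j * ‖T j - ∑ i ∈ s, a i • T i‖ ^ 2 ≤ r ^ 2 - ‖∑ i ∈ s, a i • T i‖ ^ 2 := by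
  set c := ∑ i ∈ s, a i • T i with hc
  have h1 : ∑ i ∈ s, a i * ‖T i - c‖ ^ 2 = ∑ i ∈ s, a i * ‖T i‖ ^ 2 - ‖c‖ ^ 2 := by
    have h2 : ∀ i ∈ s, a i * ‖T i - c‖ ^ 2
        = a i * ‖T i‖ ^ 2 - 2 * inner ℝ (a i • T i) c + a i * ‖c‖ ^ 2 := by
      intro i _
      rw [norm_sub_sq_real, real_inner_smul_left]
      ring
    rw [Finset.sum_congr rfl h2, Finset.sum_add_distrib, Finset.sum_sub_distrib,
      ← Finset.mul_sum, ← sum_inner, ← hc, real_inner_self_eq_norm_sq, ← Finset.sum_mul, ha1]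
    ring
  have h3 : ∑ i ∈ s, a i * ‖T i‖ ^ 2 ≤ r ^ 2 := by
    calc _ ≤ ∑ i ∈ s, a i * r ^ 2 := by
          refine Finset.sum_le_sum fun i hi => mul_le_mul_of_nonneg_left ?_ (ha i hi)
          exact pow_le_pow_left₀ (norm_nonneg _) (hT i hi) 2
      _ = r ^ 2 := by rw [← Finset.sum_mul, ha1, one_mul]
  calc _ ≤ ∑ i ∈ s, a i * ‖T i - c‖ ^ 2 :=
        Finset.single_le_sum (f := fun i => a i * ‖T i - c‖ ^ 2)
          (fun i hi => mul_nonneg (ha i hi) (sq_nonneg _)) hj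
    _ ≤ _ := by rw [h1]; linarith

theorem exists_tendsto_of_le_convex {b : ℕ → ℝ} {s r : ℝ} (hs : 0 < s) (hr : 0 < r)
    (hsr : s + r = 1) (hb0 : ∀ n, 0 ≤ b n)
    (hb : ∀ n, b (n + 2) ≤ s * b (n + 1) + r * b n) : ∃ β, Tendsto b atTop (𝓝 β) := by
  set M : ℕ → ℝ := fun n => max (b (n + 1)) (b n) with hM
  have hanti : Antitone M := by
    refine antitone_nat_of_succ_le fun n => max_le ?_ (le_max_left _ _)
    have h1 := le_max_left (b (n + 1)) (b n)
    have h2 := le_max_right (b (n + 1)) (b n)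
    have := hb n
    change b (n + 2) ≤ max (b (n + 1)) (b n)
    calc b (n + 2) ≤ s * max (b (n + 1)) (b n) + r * max (b (n + 1)) (b n) := by nlinarith
      _ = _ := by rw [← add_mul, hsr, one_mul]
  have hbdd : BddBelow (Set.range M) := ⟨0, by
    rintro _ ⟨n, rfl⟩
    exact (hb0 n).trans (le_max_right _ _)⟩
  set β := ⨅ n, M n with hβ
  have hlim : Tendsto M atTop (𝓝 β) := tendsto_atTop_ciInf hanti hbdd
  have hle : ∀ n, β ≤ M n := fun n => ciInf_le hbdd n
  refine ⟨β, ?_⟩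
  rw [Metric.tendsto_atTop]
  intro ε hε
  obtain ⟨n₀, hn₀⟩ := Metric.tendsto_atTop.1 hlim (s * r * ε / 2) (by positivity)
  refine ⟨n₀, fun n hn => ?_⟩
  have h1 := hn₀ n hn
  rw [Real.dist_eq, abs_of_nonneg (sub_nonneg.2 (hle n))] at h1
  have h2 : b (n + 1) ≤ M n := le_max_left _ _
  have h3 : b n ≤ M n := le_max_right _ _
  have hs1 : s < 1 := by linarith
  have hr1 : r < 1 := by linarith
  have hsr1 : s ^ 2 + r ≤ 1 := by nlinarith
  have hsr2 : s * r * ε ≤ ε :=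
    mul_le_of_le_one_left hε.le (mul_le_one₀ hs1.le hr.le hr1.le)
  rw [Real.dist_eq, abs_lt]
  refine ⟨?_, by linarith⟩
  -- A drop of `b` at `n` would force two consecutive values below the limit of the maxima.
  by_contra hcon
  have h4 : b n ≤ β - ε := by linarith
  have h5 : b (n + 1) ≤ β + s * r * ε / 2 := by linarith
  have h6 : b (n + 2) ≤ β - r * ε + s * (s * r * ε / 2) :=
    calc b (n + 2) ≤ s * b (n + 1) + r * b n := hb n
      _ ≤ s * (β + s * r * ε / 2) + r * (β - ε) := by gcongr
      _ = _ := by linear_combination β * hsr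
  have h7 : b (n + 3) ≤ β - s * r * ε + (s ^ 2 + r) * (s * r * ε / 2) :=
    calc b (n + 3) ≤ s * b (n + 2) + r * b (n + 1) := hb (n + 1)
      _ ≤ s * (β - r * ε + s * (s * r * ε / 2)) + r * (β + s * r * ε / 2) := by gcongr
      _ = _ := by linear_combination β * hsr
  have hpos : 0 < s * r * ε := by positivity
  have hpos' : 0 < r * ε := by positivity
  have h8 : b (n + 2) < β := by nlinarith
  have h9 : b (n + 3) < β := by
    have := mul_le_mul_of_nonneg_right hsr1 (half_pos hpos).le
    linarith
  exact absurd (hle (n + 2)) (not_le.2 (max_lt h9 h8))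

section Decay

variable {m : ℕ} (p : PMF (Fin (m + 1))) (k : ℝ)

theorem exists_tendsto_norm_relAmplitude (hm : 1 ≤ m) :
    ∃ β, Tendsto (fun n => ‖relAmplitude m p k n‖) atTop (𝓝 β) := by
  have h0 := lam_pos hm
  have hm0 : (0 : ℝ) < m := by exact_mod_cast hm
  refine exists_tendsto_of_le_convex (s := m * (lam m)⁻¹) (r := (lam m ^ 2)⁻¹) (by positivity)
    (by positivity) ?_ (fun n => norm_nonneg _) fun n => ?_
  · have := lam_sq m
    field_simp
    linarith
  · have hp : ∑ i, (p i).toReal = 1 := by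
      have := sum_toReal (q := p) (Set.toFinite _)
      rw [← this]
      refine (Finset.sum_subset (Finset.subset_univ _) fun i _ hi => ?_).symm
      have : p i = 0 := by simpa [PMF.mem_support_iff] using hi
      simp [this]
    rw [relAmplitude_add_two p k n hm, Finset.sum_product]
    calc _ ≤ ∑ i : Fin (m + 1), (p i).toReal * (m * (lam m)⁻¹ * ‖relAmplitude m p k (n + 1)‖
          + (lam m ^ 2)⁻¹ * ‖relAmplitude m p k n‖) := by
          refine norm_sum_le_of_le _ fun i _ => ?_
          simp only [mul_smul, ← Finset.smul_sum]
          rw [norm_smul, Real.norm_of_nonneg ENNReal.toReal_nonneg]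
          refine mul_le_mul_of_nonneg_left ?_ ENNReal.toReal_nonneg
          calc _ ≤ ∑ l ∈ Finset.range (m + 1), weight m l * (if l < m then
                ‖relAmplitude m p k (n + 1)‖ else ‖relAmplitude m p k n‖) := by
                refine norm_sum_le_of_le _ fun l _ => ?_
                rw [norm_smul, Real.norm_of_nonneg (weight_pos hm l).le]
                exact mul_le_mul_of_nonneg_left (norm_summand_le p k n i l) (weight_pos hm l).le
            _ = _ := by
                have h : ∀ l ∈ Finset.range m, weight m l * (if l < m then
                    ‖relAmplitude m p k (n + 1)‖ else ‖relAmplitude m p k n‖)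
                    = (lam m)⁻¹ * ‖relAmplitude m p k (n + 1)‖ := fun l hl => by
                  rw [weight, if_pos (Finset.mem_range.1 hl), if_pos (Finset.mem_range.1 hl)]
                rw [Finset.sum_range_succ, Finset.sum_congr rfl h, weight, if_neg (lt_irrefl m),
                  if_neg (lt_irrefl m)]
                simp
                ring
      _ = _ := by rw [← Finset.sum_mul, hp, one_mul]

/-- Since the relative amplitudes converge in modulus, all the summands of the recursion that have
positive weight must align asymptotically. -/
theorem tendsto_relAmplitude_sub_summand (hm : 1 ≤ m) {i : Fin (m + 1)} (hi : p i ≠ 0) {l : ℕ}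
    (hl : l ≤ m) :
    Tendsto (fun n => summand m p k n i l - relAmplitude m p k (n + 2)) atTop (𝓝 0) := by
  obtain ⟨β, hβ⟩ := exists_tendsto_norm_relAmplitude p k hm
  have hβ1 := hβ.comp (tendsto_add_atTop_nat 1)
  have hβ2 := hβ.comp (tendsto_add_atTop_nat 2)
  set a := (p i).toReal * weight m l with ha
  have ha0 : 0 < a := mul_pos (ENNReal.toReal_pos hi (p.apply_ne_top i)) (weight_pos hm l)
  have hsum : ∑ x ∈ (Finset.univ : Finset (Fin (m + 1))) ×ˢ Finset.range (m + 1),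
      (p x.1).toReal * weight m x.2 = 1 := by
    have h1 := sum_toReal (q := p) (Set.toFinite _)
    rw [Finset.sum_product]
    simp only [← Finset.mul_sum, sum_weight hm, mul_one]
    rw [← h1]
    refine (Finset.sum_subset (Finset.subset_univ _) fun i _ hi => ?_).symm
    have : p i = 0 := by simpa [PMF.mem_support_iff] using hi
    simp [this]
  have hbound : ∀ n, ‖summand m p k n i l - relAmplitude m p k (n + 2)‖ ^ 2
      ≤ a⁻¹ * ((max ‖relAmplitude m p k (n + 1)‖ ‖relAmplitude m p k n‖) ^ 2
        - ‖relAmplitude m p k (n + 2)‖ ^ 2) := by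
    intro n
    have h := weight_mul_norm_sub_sq_le
      ((Finset.univ : Finset (Fin (m + 1))) ×ˢ Finset.range (m + 1))
      (fun x => (p x.1).toReal * weight m x.2) (fun x => summand m p k n x.1 x.2)
      (r := max ‖relAmplitude m p k (n + 1)‖ ‖relAmplitude m p k n‖)
      (fun x _ => mul_nonneg ENNReal.toReal_nonneg (weight_pos hm _).le) hsum
      (fun x _ => (norm_summand_le p k n x.1 x.2).trans (by
        split_ifs
        exacts [le_max_left _ _, le_max_right _ _])) (j := (i, l))
      (by simpa using Nat.lt_succ_iff.2 hl)
    rw [← relAmplitude_add_two p k n hm] at h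
    rwa [← div_eq_inv_mul, le_div_iff₀' ha0]
  have hlim : Tendsto (fun n => a⁻¹ * ((max ‖relAmplitude m p k (n + 1)‖
      ‖relAmplitude m p k n‖) ^ 2 - ‖relAmplitude m p k (n + 2)‖ ^ 2)) atTop (𝓝 0) := by
    have := (((hβ1.max hβ).pow 2).sub (hβ2.pow 2)).const_mul a⁻¹
    simpa using this
  have hsq := squeeze_zero (fun n => sq_nonneg _) hbound hlim
  rw [tendsto_zero_iff_norm_tendsto_zero]
  have := hsq.sqrt
  simpa [Real.sqrt_sq (norm_nonneg _)] using this

theorem phase_add_two (m : ℕ) (k : ℝ) (hm : m = 1) (n : ℕ) :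
    phase m k (n + 2) = phase m k (n + 1) * phase m k n := by
  have h := lam_sq m
  rw [phase, phase, phase, ← wave_add]
  congr 1
  subst hm
  push_cast at h
  linear_combination lam 1 ^ n * h

/-- The alignment of the summands of the recursion makes the phases tend to `1` as far as the
amplitudes do not vanish. -/
theorem exists_tendsto_phase_sub_one_mul (hm : 1 ≤ m) : ∃ j l : ℕ,
    Tendsto (fun n => (phase m k (n + j) - 1) * relAmplitude m p k (n + l)) atTop (𝓝 0) := by
  obtain ⟨i, hi⟩ := p.support_nonempty
  have hi : p i ≠ 0 := hi
  have him : (i : ℕ) ≤ m := Nat.lt_succ_iff.1 i.2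
  have H := fun {l : ℕ} (hl : l ≤ m) => tendsto_relAmplitude_sub_summand p k hm hi hl
  set C := relAmplitude m p k with hC
  have hshift : ∀ {f : ℕ → ℂ}, Tendsto f atTop (𝓝 0) →
      Tendsto (fun n => f (n + 1)) atTop (𝓝 0) := fun h => h.comp (tendsto_add_atTop_nat 1)
  have hphase : ∀ {f : ℕ → ℂ} (d : ℕ), Tendsto f atTop (𝓝 0) →
      Tendsto (fun n => phase m k (n + d) * f n) atTop (𝓝 0) := fun d h => by
    rw [tendsto_zero_iff_norm_tendsto_zero] at h ⊢
    simpa [norm_phase] using h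
  have hm0 : 0 < m := hm
  rcases Nat.eq_zero_or_pos (i : ℕ) with hi0 | hi0
  · -- The word starts with `b`: amplitudes at distance two align.
    have h0 : Tendsto (fun n => phase m k (n + 1) * C (n + 1) - C (n + 2)) atTop (𝓝 0) := by
      simpa only [summand, hi0, if_pos hm0, lt_irrefl, if_false, pow_zero, mul_one]
        using H (Nat.zero_le m)
    have h1 : Tendsto (fun n => C n - C (n + 2)) atTop (𝓝 0) := by
      simpa only [summand, hi0, lt_irrefl, if_false, pow_zero, one_mul] using H le_rfl
    rcases Nat.lt_or_ge 1 m with hm1 | hm1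
    · have h2 : Tendsto (fun n => phase m k (n + 1) * phase m k (n + 2) * C (n + 1) - C (n + 2))
          atTop (𝓝 0) := by
        simpa only [summand, hi0, if_pos hm1, Nat.not_lt_zero, if_false, pow_one] using H hm1.le
      refine ⟨2, 1, tendsto_zero_iff_norm_tendsto_zero.2 ?_⟩
      have h3 := tendsto_zero_iff_norm_tendsto_zero.1 (by simpa using h2.sub h0)
      refine h3.congr fun n => ?_
      rw [show phase m k (n + 1) * phase m k (n + 2) * C (n + 1) -
        phase m k (n + 1) * C (n + 1)
        = phase m k (n + 1) * ((phase m k (n + 2) - 1) * C (n + 1)) by ring, norm_mul,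
        norm_phase, one_mul]
    · refine ⟨3, 1, ?_⟩
      have h3 := ((hphase 2 h0).add (hshift h0)).sub (hshift h1)
      simp only [add_zero, sub_zero] at h3
      refine h3.congr fun n => ?_
      rw [phase_add_two m k (by omega) (n + 1)]
      ring
  · -- The word starts with `a`: consecutive amplitudes align.
    have h0 : Tendsto (fun n => C (n + 1) - C (n + 2)) atTop (𝓝 0) := by
      simpa only [summand, if_pos hi0, if_pos hm0, pow_zero, one_mul] using H (Nat.zero_le m)
    rcases Nat.lt_or_ge 1 i with hi1 | hi1
    · refine ⟨2, 1, ?_⟩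
      have h1 : Tendsto (fun n => phase m k (n + 2) * C (n + 1) - C (n + 2)) atTop (𝓝 0) := by
        simpa only [summand, if_pos (hi1.trans_le him), if_pos hi1, pow_one] using H hm
      have h2 := h1.sub h0
      rw [sub_zero] at h2
      refine h2.congr fun n => ?_
      ring
    · refine ⟨3, 1, ?_⟩
      have hi1 : (i : ℕ) = 1 := by omega
      have h1 : Tendsto (fun n => phase m k (n + 2) * C n - C (n + 2)) atTop (𝓝 0) := by
        simpa only [summand, hi1, lt_irrefl, if_false, pow_one] using H le_rfl
      have h2 := ((hshift h1).sub h0).sub (hshift h0)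
      simp only [sub_zero] at h2
      refine h2.congr fun n => ?_
      ring

/-- The mean amplitudes of the inflation words are of smaller order than their lengths, for wave
numbers outside the Fourier module. -/
theorem tendsto_relAmplitude (hm : 1 ≤ m) (hk : k ∉ fourierModule m) :
    Tendsto (relAmplitude m p k) atTop (𝓝 0) := by
  obtain ⟨β, hβ⟩ := exists_tendsto_norm_relAmplitude p k hm
  rcases eq_or_ne β 0 with rfl | hβ0
  · exact tendsto_zero_iff_norm_tendsto_zero.2 hβ
  · refine absurd (mem_fourierModule_of_tendsto hm ?_) hk
    obtain ⟨j, l, hjl⟩ := exists_tendsto_phase_sub_one_mul p k hm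
    have h1 := (hβ.comp (tendsto_add_atTop_nat l)).inv₀ hβ0
    have h2 := hjl.norm.mul h1
    rw [norm_zero, zero_mul] at h2
    have h3 : Tendsto (fun n => ‖phase m k (n + j) - 1‖) atTop (𝓝 0) := by
      refine h2.congr' ?_
      filter_upwards [(hβ.comp (tendsto_add_atTop_nat l)).eventually_ne hβ0] with n hn
      simp only [Function.comp_apply] at hn
      simp only [norm_mul, Function.comp_apply]
      field_simp
    rw [tendsto_iff_norm_sub_tendsto_zero]
    exact (tendsto_add_atTop_iff_nat (f := fun n => ‖phase m k n - 1‖) j).1 h3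

end Decay

section LetterDecay

variable {m : ℕ} (p : PMF (Fin (m + 1))) (k : ℝ)

theorem tendsto_letterAmplitude_div (hm : 1 ≤ m) (hk : k ∉ fourierModule m) (c : Letter) :
    Tendsto (fun n => ‖letterAmplitude m p k c n‖ / lam m ^ n) atTop (𝓝 0) := by
  have h0 := lam_pos hm
  have ha : Tendsto (fun n => ‖letterAmplitude m p k Letter.a n‖ / lam m ^ n) atTop (𝓝 0) := by
    have := tendsto_zero_iff_norm_tendsto_zero.1 (tendsto_relAmplitude p k hm hk)
    refine this.congr fun n => ?_
    rw [relAmplitude, norm_div, norm_pow, Complex.norm_real, Real.norm_of_nonneg h0.le]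
  cases c
  · exact ha
  · rw [← tendsto_add_atTop_iff_nat 1]
    have := ha.const_mul (lam m)⁻¹
    rw [mul_zero] at this
    refine this.congr fun n => ?_
    rw [letterAmplitude_b_succ, pow_succ]
    field_simp

end LetterDecay

/-! ### Second moments of patch sums -/

section SecondMoment

variable {m : ℕ} {f g : ℝ → ℂ} {s : ℝ}

theorem norm_patchSum_le (hm : 1 ≤ m) {w : List Letter} {B : ℝ}
    (hf : ∀ y ∈ Set.Icc s (s + patchLength m w), ‖f y‖ ≤ B) :
    ‖patchSum m f s w‖ ≤ w.length * B := by
  induction w generalizing s with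
  | nil => simp
  | cons c w ih =>
    have hc := one_le_tileLength hm c
    have hw := patchLength_nonneg hm w
    rw [patchLength_cons] at hf
    rw [patchSum_cons, List.length_cons, Nat.cast_succ, add_mul, one_mul, add_comm (_ * _)]
    refine norm_add_le_of_le (hf s ⟨le_rfl, by linarith⟩) (ih fun y hy => hf y ⟨?_, ?_⟩)
    · linarith [hy.1]
    · linarith [hy.2]

theorem patchSum_eq_zero (hm : 1 ≤ m) {w : List Letter}
    (hf : ∀ y ∈ Set.Icc s (s + patchLength m w), f y = 0) : patchSum m f s w = 0 := by
  have := norm_patchSum_le (f := f) (s := s) (w := w) (B := 0) hm fun y hy => by simp [hf y hy]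
  simpa using this

theorem patchSum_sub_const_mul (a : ℂ) (w : List Letter) :
    patchSum m (fun y => f y - a * g y) s w = patchSum m f s w - a * patchSum m g s w := by
  simp only [patchSum, Finset.sum_sub_distrib, Finset.mul_sum]

/-- The number of tiles of the patch given by a word that start in `J`, where the tiles are scaled
by the factor `L` and the patch starts at the given point. -/
def tileCount (m : ℕ) (L : ℝ) (J : Set ℝ) : ℝ → List Letter → ℝ
  | _, [] => 0
  | s, c :: u => J.indicator 1 s + tileCount m L J (s + L * tileLength m c) u

theorem tileCount_nonneg (L : ℝ) (J : Set ℝ) (s : ℝ) (u : List Letter) :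
    0 ≤ tileCount m L J s u := by
  induction u generalizing s with
  | nil => exact le_rfl
  | cons c u ih => exact add_nonneg (Set.indicator_nonneg (fun _ _ => zero_le_one) _) (ih _)

theorem tileCount_le (hm : 1 ≤ m) {L α β : ℝ} (hL : 0 < L) (hαβ : α ≤ β) (s : ℝ)
    (u : List Letter) : tileCount m L (Set.Icc α β) s u ≤ (β - α) / L + 1 := by
  suffices h : tileCount m L (Set.Icc α β) s u ≤ max 0 ((β - max s α) / L + 1) by
    refine h.trans (max_le ?_ ?_)
    · have : 0 ≤ (β - α) / L := div_nonneg (by linarith) hL.le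
      linarith
    · gcongr
      exact le_max_right _ _
  induction u generalizing s with
  | nil => exact le_max_left _ _
  | cons c u ih =>
    have hc : L ≤ L * tileLength m c := le_mul_of_one_le_right hL.le (one_le_tileLength hm c)
    have h1 := ih (s + L * tileLength m c)
    rw [tileCount]
    by_cases hs : s ∈ Set.Icc α β
    · have h2 : (β - max (s + L * tileLength m c) α) / L + 1 ≤ (β - s) / L := by
        have h3 : (β - max (s + L * tileLength m c) α) / L ≤ (β - (s + L)) / L := by
          gcongr
          exact le_trans (by linarith) (le_max_left _ _)
        have h4 : (β - (s + L)) / L = (β - s) / L - 1 := by field_simp; ring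
        linarith
      have h5 : 0 ≤ (β - s) / L := div_nonneg (by linarith [hs.2]) hL.le
      rw [Set.indicator_of_mem hs, Pi.one_apply, max_eq_left hs.1]
      refine le_max_of_le_right ?_
      have := h1.trans (max_le h5 h2)
      linarith
    · rw [Set.indicator_of_notMem hs, zero_add]
      refine h1.trans (max_le_max le_rfl ?_)
      gcongr
      linarith

variable {σ : RandomSubstitution Letter} {L : ℝ}

theorem mean_patchSum_cons (hσ : ∀ c, (σ c).support.Finite)
    (hL : ∀ c, ∀ w ∈ (σ c).support, patchLength m w = L * tileLength m c) (c : Letter)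
    (u : List Letter) :
    mean (σ.onWord (c :: u)) (patchSum m f s)
      = mean (σ c) (patchSum m f s)
        + mean (σ.onWord u) (patchSum m f (s + L * tileLength m c)) := by
  have hu := RandomSubstitution.support_onWord_finite hσ u
  rw [RandomSubstitution.mean_onWord_cons hσ]
  have h : ∀ v ∈ (σ c).support, mean (σ.onWord u) (fun w => patchSum m f s (v ++ w))
      = patchSum m f s v + mean (σ.onWord u) (patchSum m f (s + L * tileLength m c)) := by
    intro v hv
    simp only [patchSum_append, hL c v hv]
    rw [mean_add hu, mean_const hu]
  rw [mean_congr h, mean_add (hσ c), mean_const (hσ c)]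

/-- The supertiles are independent and have deterministic positions, so the second moment of a sum
over a patch is at most the square of its mean plus the sum of the second moments of the
contributions of the individual supertiles. -/
theorem mean_norm_sq_patchSum_le (hσ : ∀ c, (σ c).support.Finite)
    (hL : ∀ c, ∀ w ∈ (σ c).support, patchLength m w = L * tileLength m c) {J : Set ℝ} {V : ℝ}
    (hV : ∀ c s, mean (σ c) (fun w => ‖patchSum m f s w‖ ^ 2) ≤ V * J.indicator 1 s)
    (u : List Letter) :
    mean (σ.onWord u) (fun w => ‖patchSum m f s w‖ ^ 2)
      ≤ ‖mean (σ.onWord u) (patchSum m f s)‖ ^ 2 + V * tileCount m L J s u := by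
  induction u generalizing s with
  | nil => simp [RandomSubstitution.onWord, mean_pure, tileCount]
  | cons c u ih =>
    have hu := RandomSubstitution.support_onWord_finite hσ u
    set s' := s + L * tileLength m c with hs'
    set Y := mean (σ.onWord u) (patchSum m f s') with hY
    set X := mean (σ c) (patchSum m f s) with hX
    have h1 : ∀ v ∈ (σ c).support, mean (σ.onWord u) (fun w => ‖patchSum m f s (v ++ w)‖ ^ 2)
        = ‖patchSum m f s v‖ ^ 2 + (2 * inner ℝ Y (patchSum m f s v)
          + mean (σ.onWord u) (fun w => ‖patchSum m f s' w‖ ^ 2)) := by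
      intro v hv
      have h2 := mean_clm hu (innerSL ℝ (patchSum m f s v)) (patchSum m f s')
      simp only [innerSL_apply_apply] at h2
      simp only [patchSum_append, hL c v hv, norm_add_sq_real, ← hs', add_assoc]
      rw [mean_add hu, mean_const hu, mean_add hu, mean_const_mul_real hu, h2, ← hY,
        real_inner_comm]
    have h3 := mean_clm (hσ c) (innerSL ℝ Y) (patchSum m f s)
    simp only [innerSL_apply_apply] at h3
    rw [RandomSubstitution.mean_onWord_cons hσ, mean_congr h1, mean_add (hσ c), mean_add (hσ c),
      mean_const (hσ c), mean_const_mul_real (hσ c), h3, ← hX, mean_patchSum_cons hσ hL, ← hX,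
      ← hs', ← hY, norm_add_sq_real, tileCount, ← hs']
    have h4 := hV c s
    have h5 := ih (s := s')
    rw [← hY] at h5
    have h6 := real_inner_comm X Y
    nlinarith [sq_nonneg ‖X‖]

theorem norm_mean_patchSum_le (hσ : ∀ c, (σ c).support.Finite)
    (hL : ∀ c, ∀ w ∈ (σ c).support, patchLength m w = L * tileLength m c) {J : Set ℝ} {η : ℝ}
    (hη : ∀ c s, ‖mean (σ c) (patchSum m f s)‖ ≤ η * J.indicator 1 s) (u : List Letter) :
    ‖mean (σ.onWord u) (patchSum m f s)‖ ≤ η * tileCount m L J s u := by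
  induction u generalizing s with
  | nil => simp [RandomSubstitution.onWord, mean_pure, tileCount]
  | cons c u ih =>
    rw [mean_patchSum_cons hσ hL, tileCount, mul_add]
    exact norm_add_le_of_le (hη c s) ih

end SecondMoment

/-! ### Modulated windows -/

/-- The profile of a window: a smooth function with positive integral, supported in `[-1, 0]` and
bounded by `1`. -/
structure IsProfile (h : ℝ → ℝ) : Prop where
  contDiff : ContDiff ℝ (⊤ : ℕ∞) h
  eq_zero : ∀ x, x ∉ Set.Icc (-1 : ℝ) 0 → h x = 0
  abs_le_one : ∀ x, |h x| ≤ 1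
  integral_pos : 0 < ∫ x, h x

theorem exists_isProfile : ∃ h : ℝ → ℝ, IsProfile h := by
  let b : ContDiffBump (-1 / 2 : ℝ) := ⟨1 / 4, 1 / 2, by norm_num, by norm_num⟩
  refine ⟨b, b.contDiff, fun x hx => b.zero_of_le_dist ?_, fun x => ?_, b.integral_pos⟩
  · by_contra hlt
    rw [not_le, Real.dist_eq, abs_lt] at hlt
    have h1 : b.rOut = 1 / 2 := rfl
    rw [h1] at hlt
    exact hx ⟨by linarith [hlt.1], by linarith [hlt.2]⟩
  · rw [abs_of_nonneg b.nonneg]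
    exact b.le_one

/-- The window of length `R` with profile `h`, scaled so that its `L¹` norm does not depend on `R`,
and modulated by the wave number `k`. -/
def window (h : ℝ → ℝ) (k R t : ℝ) : ℂ := (h (t / R) / R : ℝ) * wave (-k) t

section Window

variable {h : ℝ → ℝ} {k R : ℝ}

theorem IsProfile.hasCompactSupport (hh : IsProfile h) : HasCompactSupport h :=
  HasCompactSupport.intro isCompact_Icc hh.eq_zero

theorem contDiff_wave (k : ℝ) : ContDiff ℝ (⊤ : ℕ∞) (wave k) := by
  unfold wave
  exact Complex.contDiff_exp.comp (contDiff_const.mul Complex.ofRealCLM.contDiff)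

theorem contDiff_window (hh : IsProfile h) : ContDiff ℝ (⊤ : ℕ∞) (window h k R) := by
  unfold window
  exact (Complex.ofRealCLM.contDiff.comp
    ((hh.contDiff.comp (contDiff_id.div_const R)).div_const R)).mul (contDiff_wave _)

theorem window_eq_zero (hh : IsProfile h) (hR : 0 < R) {t : ℝ} (ht : t ∉ Set.Icc (-R) 0) :
    window h k R t = 0 := by
  rw [window, hh.eq_zero]
  · simp
  · intro hmem
    refine ht ⟨?_, ?_⟩
    · have := (le_div_iff₀ hR).1 hmem.1
      linarith
    · have := (div_le_iff₀ hR).1 hmem.2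
      linarith

theorem norm_window_le (hh : IsProfile h) (hR : 0 < R) (t : ℝ) : ‖window h k R t‖ ≤ R⁻¹ := by
  rw [window, norm_mul, norm_wave, mul_one, Complex.norm_real, norm_div,
    Real.norm_of_nonneg hR.le, ← one_div]
  gcongr
  exact hh.abs_le_one _

theorem wave_neg_sub (k t y : ℝ) : wave (-k) (t - y) = wave (-k) t * wave k y := by
  rw [wave, wave, wave, ← Complex.exp_add]
  push_cast
  ring_nf

/-- On a patch that is short with respect to the window, the profile is nearly constant, so that
the windowed sum is nearly a multiple of the amplitude of the patch. -/
theorem norm_patchSum_window_sub_le {m : ℕ} (hm : 1 ≤ m) {K : NNReal} (hK : LipschitzWith K h)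
    (hR : 0 < R) (t s : ℝ) {w : List Letter} {l : ℝ} (hl : patchLength m w ≤ l) :
    ‖patchSum m (fun y => window h k R (t - y)) s w
      - ((h ((t - s) / R) / R : ℝ) * wave (-k) t * wave k s) * patchAmplitude m k w‖
      ≤ K * l ^ 2 / R ^ 2 := by
  rw [mul_assoc, ← patchSum_wave, ← patchSum_sub_const_mul]
  have h0 : 0 ≤ l := (patchLength_nonneg hm w).trans hl
  have hlen : (w.length : ℝ) ≤ l := (length_le_patchLength hm w).trans hl
  refine (norm_patchSum_le (B := K * l / R ^ 2) hm fun y hy => ?_).trans ?_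
  · rw [window, wave_neg_sub, ← mul_assoc, ← sub_mul, ← sub_mul, ← Complex.ofReal_sub, norm_mul,
      norm_mul, norm_wave, norm_wave, mul_one, mul_one, Complex.norm_real, ← sub_div, norm_div,
      Real.norm_of_nonneg hR.le]
    have h1 := hK.dist_le_mul ((t - y) / R) ((t - s) / R)
    rw [Real.dist_eq, Real.dist_eq, ← sub_div, abs_div, abs_of_pos hR,
      show t - y - (t - s) = -(y - s) by ring, abs_neg,
      abs_of_nonneg (show 0 ≤ y - s by linarith [hy.1])] at h1
    rw [Real.norm_eq_abs, div_le_iff₀ hR]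
    refine h1.trans ?_
    have h2 : y - s ≤ l := by linarith [hy.2]
    calc K * ((y - s) / R) ≤ K * (l / R) := by gcongr
      _ = K * l / R ^ 2 * R := by field_simp
  · calc (w.length : ℝ) * (K * l / R ^ 2) ≤ l * (K * l / R ^ 2) := by gcongr
      _ = _ := by ring

/-- For wave numbers outside the Fourier module, windowed sums over inflated words are small in
quadratic mean, as soon as the window is much longer than the supertiles of a suitable level. -/
theorem exists_level_mean_norm_sq_le {m : ℕ} (hm : 1 ≤ m) (p : PMF (Fin (m + 1)))
    (hk : k ∉ fourierModule m) (hh : IsProfile h) {ε : ℝ} (hε : 0 < ε) :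
    ∃ N : ℕ, ∀ᶠ R : ℝ in atTop, ∀ (t s : ℝ) (u : List Letter),
      mean (RandomSubstitution.onWord (fun c => (nobleMeans m p).iterate c N) u)
        (fun w => ‖patchSum m (fun y => window h k R (t - y)) s w‖ ^ 2) ≤ ε := by
  have h0 := lam_pos hm
  obtain ⟨K, hK⟩ := hh.contDiff.lipschitzWith_of_hasCompactSupport hh.hasCompactSupport (by simp)
  have hsum := ((tendsto_letterAmplitude_div p k hm hk Letter.a).add
    (tendsto_letterAmplitude_div p k hm hk Letter.b)).pow 2
  obtain ⟨N, hN⟩ := (hsum.eventually_lt_const (by simpa using hε)).exists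
  refine ⟨N, ?_⟩
  set σ : RandomSubstitution Letter := fun c => (nobleMeans m p).iterate c N with hσdef
  set L := lam m ^ N with hL
  have hL0 : 0 < L := by positivity
  set A := ‖letterAmplitude m p k Letter.a N‖ + ‖letterAmplitude m p k Letter.b N‖ with hA
  set l := L * lam m with hl
  rw [← add_div] at hN
  -- For fixed `N`, the bound on the second moment converges to `(A / L) ^ 2 < ε` as `R → ∞`.
  have hlim : Tendsto (fun R : ℝ => ((A + K * l ^ 2 * R⁻¹) * (((1 + l * R⁻¹) / L + R⁻¹))) ^ 2
      + l ^ 2 * R⁻¹ * ((1 + l * R⁻¹) / L + R⁻¹)) atTop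
      (𝓝 (((A + K * l ^ 2 * 0) * (((1 + l * 0) / L + 0))) ^ 2
        + l ^ 2 * 0 * ((1 + l * 0) / L + 0))) := by
    have hi := tendsto_inv_atTop_zero (𝕜 := ℝ)
    have h1 : Tendsto (fun R : ℝ => (1 + l * R⁻¹) / L + R⁻¹) atTop
        (𝓝 ((1 + l * 0) / L + 0)) := (((hi.const_mul l).const_add 1).div_const L).add hi
    exact ((((hi.const_mul _).const_add A).mul h1).pow 2).add ((hi.const_mul _).mul h1)
  have hlt := hlim.eventually_lt_const (u := ε) (by simpa [← div_eq_mul_inv] using hN)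
  filter_upwards [hlt, eventually_gt_atTop 0] with R hRlt hR t s u
  have hfin : ∀ c, (σ c).support.Finite := fun c => support_iterate_nobleMeans_finite m p c N
  have hlen : ∀ c, ∀ w ∈ (σ c).support, patchLength m w = L * tileLength m c := fun c w hw =>
    patchLength_of_mem_support_iterate m p hw
  have hlen' : ∀ c, ∀ w ∈ (σ c).support, patchLength m w ≤ l := fun c w hw => by
    rw [hlen c w hw]
    exact mul_le_mul_of_nonneg_left (tileLength_le hm c) hL0.le
  have hl0 : 0 < l := mul_pos hL0 h0
  set J := Set.Icc (t - l) (t + R) with hJ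
  set f : ℝ → ℂ := fun y => window h k R (t - y) with hf
  have hzero : ∀ c s, s ∉ J → ∀ w ∈ (σ c).support, patchSum m f s w = 0 := by
    intro c s hs w hw
    refine patchSum_eq_zero hm fun y hy => window_eq_zero hh hR fun hmem => hs ⟨?_, ?_⟩
    · linarith [hy.2, hmem.2, hlen' c w hw]
    · linarith [hy.1, hmem.1]
  set η := (A + K * l ^ 2 * R⁻¹) * R⁻¹ with hη
  set V := (l * R⁻¹) ^ 2 with hV
  have hA0 : 0 ≤ A := by positivity
  have hη0 : 0 ≤ η := by positivity
  have hηb : ∀ c s, ‖mean (σ c) (patchSum m f s)‖ ≤ η * J.indicator 1 s := by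
    intro c s
    by_cases hs : s ∈ J
    · rw [Set.indicator_of_mem hs, Pi.one_apply, mul_one]
      set a : ℂ := (h ((t - s) / R) / R : ℝ) * wave (-k) t * wave k s with ha
      have ha1 : ‖a‖ ≤ R⁻¹ := by
        rw [ha, norm_mul, norm_mul, norm_wave, norm_wave, mul_one, mul_one, Complex.norm_real,
          norm_div, Real.norm_of_nonneg hR.le, ← one_div]
        gcongr
        exact hh.abs_le_one _
      have h1 : ‖mean (σ c) (fun w => patchSum m f s w - a * patchAmplitude m k w)‖
          ≤ K * l ^ 2 / R ^ 2 :=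
        norm_mean_le (hfin c) fun w hw => norm_patchSum_window_sub_le hm hK hR t s (hlen' c w hw)
      have h2 : mean (σ c) (patchSum m f s)
          = mean (σ c) (fun w => patchSum m f s w - a * patchAmplitude m k w)
            + a * letterAmplitude m p k c N := by
        rw [letterAmplitude, ← mean_const_mul (hfin c), ← mean_add (hfin c)]
        simp
      have h3 : ‖letterAmplitude m p k c N‖ ≤ A := by
        cases c <;> simp [hA]
      rw [h2]
      calc _ ≤ K * l ^ 2 / R ^ 2 + R⁻¹ * A := by
            refine norm_add_le_of_le h1 ?_
            rw [norm_mul]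
            gcongr
        _ = η := by rw [hη]; field_simp; ring
    · rw [Set.indicator_of_notMem hs, mul_zero]
      exact norm_mean_le (hfin c) fun w hw => by rw [hzero c s hs w hw, norm_zero]
  have hVb : ∀ c s, mean (σ c) (fun w => ‖patchSum m f s w‖ ^ 2) ≤ V * J.indicator 1 s := by
    intro c s
    by_cases hs : s ∈ J
    · rw [Set.indicator_of_mem hs, Pi.one_apply, mul_one, ← mean_const (hfin c) V]
      refine mean_mono (hfin c) fun w hw => ?_
      refine pow_le_pow_left₀ (norm_nonneg _) ?_ 2
      refine (norm_patchSum_le (B := R⁻¹) hm fun y _ => norm_window_le hh hR _).trans ?_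
      gcongr
      exact (length_le_patchLength hm w).trans (hlen' c w hw)
    · rw [Set.indicator_of_notMem hs, mul_zero, ← mean_const (hfin c) (0 : ℝ)]
      exact mean_mono (hfin c) fun w hw => by simp [hzero c s hs w hw]
  have hcount : tileCount m L J s u ≤ (R + l) / L + 1 := by
    have := tileCount_le hm (α := t - l) (β := t + R) hL0 (by linarith) s u
    rwa [show t + R - (t - l) = R + l by ring] at this
  have hc0 := tileCount_nonneg (m := m) L J s u
  calc _ ≤ ‖mean (σ.onWord u) (patchSum m f s)‖ ^ 2 + V * tileCount m L J s u :=
        mean_norm_sq_patchSum_le hfin hlen hVb u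
    _ ≤ (η * ((R + l) / L + 1)) ^ 2 + V * ((R + l) / L + 1) := by
        have h1 := norm_mean_patchSum_le (s := s) hfin hlen hηb u
        gcongr
        exact h1.trans (mul_le_mul_of_nonneg_left hcount hη0)
    _ = _ := by
        rw [hη, hV]
        field_simp
    _ ≤ ε := hRlt.le

end Window

/-! ### The energy of a windowed patch -/

/-- A continuous function supported in `[-R, 0]` and bounded by `B`. -/
structure IsWindow (g : ℝ → ℂ) (R B : ℝ) : Prop where
  continuous : Continuous g
  pos : 0 < R
  eq_zero : ∀ t, t ∉ Set.Icc (-R) 0 → g t = 0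
  norm_le : ∀ t, ‖g t‖ ≤ B

theorem isWindow_window {h : ℝ → ℝ} {k R : ℝ} (hh : IsProfile h) (hR : 0 < R) :
    IsWindow (window h k R) R R⁻¹ :=
  ⟨(contDiff_window hh).continuous, hR, fun _ => window_eq_zero hh hR, norm_window_le hh hR⟩

/-- The sum of the translates of the function `g` to the left endpoints of the patch. -/
def windowSum (m : ℕ) (g : ℝ → ℂ) (s : ℝ) (w : List Letter) (t : ℝ) : ℂ :=
  patchSum m (fun y => g (t - y)) s w

/-- The square integral of the sum of the translates of `g` to the left endpoints of a patch. -/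
def energy (m : ℕ) (g : ℝ → ℂ) (w : List Letter) : ℝ := ∫ t, ‖windowSum m g 0 w t‖ ^ 2

/-- The part of the energy that belongs to the first tile of the patch: the integral extends over
that tile only. -/
def headEnergy (m : ℕ) (g : ℝ → ℂ) : List Letter → ℝ
  | [] => 0
  | c :: u => ∫ t in Set.Ioc 0 (tileLength m c), ‖windowSum m g 0 (c :: u) t‖ ^ 2

section Energy

variable {m : ℕ} {g : ℝ → ℂ} {R B : ℝ}

theorem windowSum_cons (s : ℝ) (c : Letter) (w : List Letter) (t : ℝ) :
    windowSum m g s (c :: w) t = g (t - s) + windowSum m g (s + tileLength m c) w t :=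
  patchSum_cons _ _ _ _ _

theorem windowSum_append (s : ℝ) (u v : List Letter) (t : ℝ) :
    windowSum m g s (u ++ v) t
      = windowSum m g s u t + windowSum m g (s + patchLength m u) v t :=
  patchSum_append _ _ _ _ _

theorem windowSum_add (s a : ℝ) (w : List Letter) (t : ℝ) :
    windowSum m g (s + a) w t = windowSum m g s w (t - a) := by
  simp only [windowSum, patchSum]
  refine Finset.sum_congr rfl fun j _ => ?_
  congr 1
  ring

theorem continuous_windowSum (hg : IsWindow g R B) (s : ℝ) (w : List Letter) :
    Continuous (windowSum m g s w) := by
  unfold windowSum patchSum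
  have := hg.continuous
  fun_prop

theorem windowSum_eq_zero (hm : 1 ≤ m) (hg : IsWindow g R B) {s t : ℝ} {w : List Letter}
    (h : t < s - R ∨ s + patchLength m w < t) : windowSum m g s w t = 0 := by
  refine patchSum_eq_zero hm fun y hy => hg.eq_zero _ fun hmem => ?_
  rcases h with h | h
  · linarith [hmem.1, hy.1]
  · linarith [hmem.2, hy.2]

theorem norm_windowSum_le_tileCount (hg : IsWindow g R B) (s t : ℝ) (w : List Letter) :
    ‖windowSum m g s w t‖ ≤ B * tileCount m 1 (Set.Icc t (t + R)) s w := by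
  induction w generalizing s with
  | nil => simp [windowSum, tileCount]
  | cons c w ih =>
    rw [windowSum_cons, tileCount, mul_add, one_mul]
    refine norm_add_le_of_le ?_ (ih _)
    by_cases hs : s ∈ Set.Icc t (t + R)
    · rw [Set.indicator_of_mem hs, Pi.one_apply, mul_one]
      exact hg.norm_le _
    · rw [Set.indicator_of_notMem hs, mul_zero, hg.eq_zero, norm_zero]
      intro hmem
      exact hs ⟨by linarith [hmem.2], by linarith [hmem.1]⟩

theorem IsWindow.bound_nonneg (hg : IsWindow g R B) : 0 ≤ B :=
  (norm_nonneg _).trans (hg.norm_le 0)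

/-- Since the tile lengths are at least `1`, the number of points in a window is bounded. -/
theorem norm_windowSum_sq_le (hm : 1 ≤ m) (hg : IsWindow g R B) (s t : ℝ) (w : List Letter) :
    ‖windowSum m g s w t‖ ^ 2 ≤ (B * (R + 1)) ^ 2 := by
  refine pow_le_pow_left₀ (norm_nonneg _) ?_ 2
  refine (norm_windowSum_le_tileCount hg s t w).trans ?_
  have := tileCount_le hm one_pos (by linarith [hg.pos] : t ≤ t + R) s w
  refine mul_le_mul_of_nonneg_left ?_ hg.bound_nonneg
  simpa using this

theorem integrable_windowSum (hm : 1 ≤ m) (hg : IsWindow g R B) (s : ℝ) (w : List Letter) :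
    Integrable fun t => ‖windowSum m g s w t‖ ^ 2 := by
  refine ((continuous_windowSum hg s w).norm.pow 2).integrable_of_hasCompactSupport ?_
  refine HasCompactSupport.intro (isCompact_Icc (a := s - R) (b := s + patchLength m w))
    fun t ht => ?_
  change ‖windowSum m g s w t‖ ^ 2 = 0
  rw [windowSum_eq_zero hm hg, norm_zero, zero_pow two_ne_zero]
  by_contra hcon
  push Not at hcon
  exact ht hcon

theorem headEnergy_nonneg (w : List Letter) : 0 ≤ headEnergy m g w := by
  cases w with
  | nil => exact le_rfl
  | cons c w => exact integral_nonneg fun t => by positivity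

theorem headEnergy_le (hm : 1 ≤ m) (hg : IsWindow g R B) (w : List Letter) :
    headEnergy m g w ≤ lam m * (B * (R + 1)) ^ 2 := by
  have h0 := lam_pos hm
  cases w with
  | nil => exact mul_nonneg h0.le (sq_nonneg _)
  | cons c w =>
    have hc := one_le_tileLength hm c
    have h := norm_setIntegral_le_of_norm_le_const (μ := volume)
      (s := Set.Ioc 0 (tileLength m c)) (f := fun t => ‖windowSum m g 0 (c :: w) t‖ ^ 2)
      (C := (B * (R + 1)) ^ 2) (by simp) fun t _ => by
        rw [Real.norm_of_nonneg (by positivity)]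
        exact norm_windowSum_sq_le hm hg 0 t _
    refine (le_abs_self _).trans (h.trans ?_)
    rw [Real.volume_real_Ioc_of_le (by linarith), sub_zero, mul_comm]
    exact mul_le_mul_of_nonneg_right (tileLength_le hm c) (sq_nonneg _)

/-- The first tile sees only the tiles up to the length of the window. -/
theorem headEnergy_take (hm : 1 ≤ m) (hg : IsWindow g R B) {D : ℕ} (hD : lam m + R + 1 ≤ D)
    (w : List Letter) : headEnergy m g (w.take D) = headEnergy m g w := by
  have h0 := lam_pos hm
  have hR := hg.pos
  have hD0 : D ≠ 0 := by
    rintro rfl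
    norm_num at hD
    linarith
  rcases Nat.le_total w.length D with hw | hw
  · rw [List.take_of_length_le hw]
  obtain ⟨D, rfl⟩ := Nat.exists_eq_succ_of_ne_zero hD0
  cases w with
  | nil => simp
  | cons c w =>
    rw [List.take_succ_cons, headEnergy, headEnergy]
    refine setIntegral_congr_fun measurableSet_Ioc fun t ht => ?_
    have hsplit : c :: w = (c :: w.take D) ++ w.drop D := by simp
    have hlen : ((D + 1 : ℕ) : ℝ) ≤ patchLength m (c :: w.take D) := by
      have h1 := length_le_patchLength hm (c :: w.take D)
      rwa [show (c :: w.take D).length = D + 1 by simp at hw ⊢; exact hw] at h1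
    have hz : windowSum m g (0 + patchLength m (c :: w.take D)) (w.drop D) t = 0 := by
      refine windowSum_eq_zero hm hg (Or.inl ?_)
      have := ht.2.trans (tileLength_le hm c)
      push_cast at hD hlen
      linarith
    change _ = ‖windowSum m g 0 (c :: w) t‖ ^ 2
    rw [hsplit, windowSum_append, hz, add_zero]

theorem setIntegral_Ioi_windowSum_cons (hm : 1 ≤ m) (hg : IsWindow g R B) (c : Letter)
    (w : List Letter) :
    ∫ t in Set.Ioi 0, ‖windowSum m g 0 (c :: w) t‖ ^ 2
      = headEnergy m g (c :: w) + ∫ t in Set.Ioi 0, ‖windowSum m g 0 w t‖ ^ 2 := by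
  have hc : 0 ≤ tileLength m c := zero_le_one.trans (one_le_tileLength hm c)
  have hint := integrable_windowSum hm hg 0 (c :: w)
  have hunion := setIntegral_union (Set.Ioc_disjoint_Ioi (a := 0) (le_refl (tileLength m c)))
    measurableSet_Ioi hint.integrableOn hint.integrableOn
  rw [Set.Ioc_union_Ioi_eq_Ioi hc] at hunion
  rw [hunion, headEnergy]
  congr 1
  have h1 : ∀ t ∈ Set.Ioi (tileLength m c), ‖windowSum m g 0 (c :: w) t‖ ^ 2
      = ‖windowSum m g 0 w (t - tileLength m c)‖ ^ 2 := by
    intro t ht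
    have ht : tileLength m c < t := ht
    rw [windowSum_cons, windowSum_add, hg.eq_zero, zero_add]
    intro hmem
    linarith [hmem.2]
  rw [setIntegral_congr_fun measurableSet_Ioi h1, ← integral_indicator measurableSet_Ioi,
    ← integral_indicator measurableSet_Ioi, ← integral_sub_right_eq_self
      ((Set.Ioi 0).indicator fun t => ‖windowSum m g 0 w t‖ ^ 2) (tileLength m c)]
  congr 1
  funext t
  simp only [Set.indicator, Set.mem_Ioi, sub_pos]

theorem setIntegral_Ioi_windowSum (hm : 1 ≤ m) (hg : IsWindow g R B) (w : List Letter) :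
    ∫ t in Set.Ioi 0, ‖windowSum m g 0 w t‖ ^ 2
      = ∑ j ∈ Finset.range w.length, headEnergy m g (w.drop j) := by
  induction w with
  | nil => simp [windowSum]
  | cons c w ih =>
    rw [setIntegral_Ioi_windowSum_cons hm hg, ih, List.length_cons, Finset.sum_range_succ',
      add_comm]
    simp

theorem sum_headEnergy_le_energy (hm : 1 ≤ m) (hg : IsWindow g R B) (w : List Letter) :
    ∑ j ∈ Finset.range w.length, headEnergy m g (w.drop j) ≤ energy m g w := by
  rw [← setIntegral_Ioi_windowSum hm hg]
  exact setIntegral_le_integral (integrable_windowSum hm hg 0 w)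
    (Eventually.of_forall fun t => by positivity)

theorem energy_le (hm : 1 ≤ m) (hg : IsWindow g R B) (w : List Letter) :
    energy m g w ≤ ∑ j ∈ Finset.range w.length, headEnergy m g (w.drop j)
      + R * (B * (R + 1)) ^ 2 := by
  have hR := hg.pos
  have hint := integrable_windowSum hm hg 0 w
  rw [← setIntegral_Ioi_windowSum hm hg, energy,
    ← integral_add_compl (measurableSet_Ioi (a := (0 : ℝ))) hint]
  gcongr
  have h1 : ∫ t in (Set.Ioi (0 : ℝ))ᶜ, ‖windowSum m g 0 w t‖ ^ 2
      = ∫ t in Set.Icc (-R) 0, ‖windowSum m g 0 w t‖ ^ 2 := by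
    refine setIntegral_eq_of_subset_of_forall_sdiff_eq_zero measurableSet_Ioi.compl ?_ ?_
    · intro t ht
      simpa using ht.2
    · intro t ht
      have ht1 : t ≤ 0 := by simpa using ht.1
      rw [windowSum_eq_zero hm hg, norm_zero, zero_pow two_ne_zero]
      left
      by_contra hcon
      exact ht.2 ⟨by linarith, ht1⟩
  have h2 := norm_setIntegral_le_of_norm_le_const (μ := volume)
      (s := Set.Icc (-R) 0) (f := fun t => ‖windowSum m g 0 w t‖ ^ 2)
      (C := (B * (R + 1)) ^ 2) (by simp) fun t _ => by
        rw [Real.norm_of_nonneg (by positivity)]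
        exact norm_windowSum_sq_le hm hg 0 t _
  rw [h1]
  refine (le_abs_self _).trans (h2.trans ?_)
  rw [Real.volume_real_Icc_of_le (by linarith), mul_comm]
  simp

end Energy

/-! ### Windows in the law of the bi-infinite words -/

instance : Fintype Letter := ⟨{Letter.a, Letter.b}, fun c => by cases c <;> simp⟩

/-- The word of length `D` that a bi-infinite word shows from position `t` on. -/
def subword (x : ℤ → Letter) (t : ℤ) (D : ℕ) : List Letter := List.ofFn fun i : Fin D => x (t + i)

theorem mem_cylinder_ofFn {D : ℕ} (x : ℤ → Letter) (t : ℤ) (v : Fin D → Letter) :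
    x ∈ cylinder t (List.ofFn v) ↔ (fun i : Fin D => x (t + i)) = v := by
  simp only [cylinder, Set.mem_ofPred_eq, List.length_ofFn, List.getElem_ofFn]
  exact ⟨fun h => funext fun i => h i i.2, fun h i hi => congrFun h ⟨i, hi⟩⟩

theorem measurable_subword_fun (t : ℤ) (D : ℕ) :
    Measurable fun (x : ℤ → Letter) (i : Fin D) => x (t + i) :=
  measurable_pi_lambda _ fun _ => measurable_pi_apply _

instance : MeasurableSingletonClass Letter := ⟨fun _ => trivial⟩

theorem measurable_comp_subword (H : List Letter → ℝ) (t : ℤ) (D : ℕ) :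
    Measurable fun x => H (subword x t D) :=
  (measurable_of_finite fun v : Fin D → Letter => H (List.ofFn v)).comp
    (measurable_subword_fun t D)

theorem measurableSet_cylinder (t : ℤ) {D : ℕ} (v : Fin D → Letter) :
    MeasurableSet (cylinder t (List.ofFn v)) := by
  have : cylinder t (List.ofFn v) = (fun x (i : Fin D) => x (t + i)) ⁻¹' {v} := by
    ext x
    exact mem_cylinder_ofFn x t v
  rw [this]
  exact measurable_subword_fun t D (measurableSet_singleton v)

theorem integral_comp_subword (μ : Measure (ℤ → Letter)) [IsProbabilityMeasure μ]
    (H : List Letter → ℝ) (t : ℤ) (D : ℕ) :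
    ∫ x, H (subword x t D) ∂μ
      = ∑ v : Fin D → Letter, H (List.ofFn v) * μ.real (cylinder t (List.ofFn v)) := by
  have h : ∀ x, H (subword x t D)
      = ∑ v : Fin D → Letter,
        (cylinder t (List.ofFn v)).indicator (fun _ => H (List.ofFn v)) x := by
    intro x
    rw [Finset.sum_eq_single (fun i : Fin D => x (t + i))]
    · rw [Set.indicator_of_mem ((mem_cylinder_ofFn x t _).2 rfl)]
      rfl
    · intro v _ hv
      exact Set.indicator_of_notMem (fun hmem => hv ((mem_cylinder_ofFn x t v).1 hmem).symm) _
    · simp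
  simp only [h]
  rw [integral_finsetSum _ fun v _ =>
    (integrable_const _).indicator (measurableSet_cylinder t v)]
  refine Finset.sum_congr rfl fun v _ => ?_
  rw [integral_indicator_const _ (measurableSet_cylinder t v), smul_eq_mul, mul_comm]

theorem integrable_comp_subword (μ : Measure (ℤ → Letter)) [IsProbabilityMeasure μ]
    {H : List Letter → ℝ} {C : ℝ} (hH : ∀ v, |H v| ≤ C) (t : ℤ) (D : ℕ) :
    Integrable (fun x => H (subword x t D)) μ :=
  Integrable.of_bound (measurable_comp_subword H t D).aestronglyMeasurable C
    (Eventually.of_forall fun _ => hH _)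

theorem sum_mul_occurrences_le {H : List Letter → ℝ} (hH : ∀ v, 0 ≤ H v) (D : ℕ)
    (w : List Letter) :
    ∑ v : Fin D → Letter, H (List.ofFn v) * (occurrences (List.ofFn v) w : ℝ)
      ≤ ∑ j ∈ Finset.range w.length, H ((w.drop j).take D) := by
  have h : ∀ v : List Letter, (occurrences v w : ℝ)
      = ∑ j ∈ Finset.range w.length, if v <+: w.drop j then (1 : ℝ) else 0 := fun v => by
    rw [occurrences, Finset.sum_boole]
  simp only [h, Finset.mul_sum]
  rw [Finset.sum_comm]
  refine Finset.sum_le_sum fun j _ => ?_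
  have key : ∀ v : Fin D → Letter, List.ofFn v <+: w.drop j →
      List.ofFn v = (w.drop j).take D := fun v hv => by
    have := List.prefix_iff_eq_take.1 hv
    rwa [List.length_ofFn] at this
  by_cases hex : ∃ v : Fin D → Letter, List.ofFn v <+: w.drop j
  · obtain ⟨v, hv⟩ := hex
    rw [Finset.sum_eq_single v, if_pos hv, mul_one, key v hv]
    · intro v' _ hne
      rw [if_neg, mul_zero]
      intro hv'
      exact hne (List.ofFn_injective ((key v' hv').trans (key v hv).symm))
    · simp
  · rw [Finset.sum_eq_zero]
    · exact hH _
    · intro v _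
      rw [if_neg fun hv => hex ⟨v, hv⟩, mul_zero]

section Law

variable {m : ℕ} {p : PMF (Fin (m + 1))} {μ : Measure (ℤ → Letter)}

theorem support_wordLaw_finite (n : ℕ) : (wordLaw m p n).support.Finite :=
  support_iterate_nobleMeans_finite m p Letter.b n

theorem patchLength_of_mem_support_wordLaw {n : ℕ} {w : List Letter}
    (hw : w ∈ (wordLaw m p n).support) : patchLength m w = lam m ^ n := by
  rw [patchLength_of_mem_support_iterate m p hw, tileLength, mul_one]

/-- For long windows, the mean energy of the inflation words is at most a small multiple of their
length. -/
theorem exists_level_mean_energy_le (hm : 1 ≤ m) {k : ℝ} (hk : k ∉ fourierModule m)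
    {h : ℝ → ℝ} (hh : IsProfile h) {ε : ℝ} (hε : 0 < ε) :
    ∃ N : ℕ, ∀ᶠ R : ℝ in atTop, ∀ n,
      mean (wordLaw m p (n + N)) (energy m (window h k R)) ≤ ε * (R + lam m ^ (n + N)) := by
  obtain ⟨N, hN⟩ := exists_level_mean_norm_sq_le hm p hk hh hε
  refine ⟨N, ?_⟩
  filter_upwards [hN, eventually_gt_atTop 0] with R hR hR0 n
  have h0 := lam_pos hm
  have hg := isWindow_window (k := k) hh hR0
  have hfin := support_wordLaw_finite (m := m) (p := p) (n + N)
  have hle : ∀ t, mean (wordLaw m p (n + N)) (fun w => ‖windowSum m (window h k R) 0 w t‖ ^ 2)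
      ≤ ε := by
    intro t
    have hσ := fun c => support_iterate_nobleMeans_finite m p c N
    rw [wordLaw, RandomSubstitution.iterate_add, mean_bind
      (support_iterate_nobleMeans_finite m p _ n)
      fun u => RandomSubstitution.support_onWord_finite hσ u,
      ← mean_const (support_iterate_nobleMeans_finite m p Letter.b n) ε]
    exact mean_mono (support_iterate_nobleMeans_finite m p _ n) fun u _ => hR t 0 u
  have hzero : ∀ t, t ∉ Set.Icc (-R) (lam m ^ (n + N)) →
      mean (wordLaw m p (n + N)) (fun w => ‖windowSum m (window h k R) 0 w t‖ ^ 2) = 0 := by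
    intro t ht
    refine (mean_congr fun w hw => ?_).trans (mean_const hfin (0 : ℝ))
    rw [windowSum_eq_zero hm hg, norm_zero, zero_pow two_ne_zero]
    rw [patchLength_of_mem_support_wordLaw hw]
    by_contra hcon
    push Not at hcon
    exact ht ⟨by linarith [hcon.1], by linarith [hcon.2]⟩
  have hnn : ∀ t, 0 ≤ mean (wordLaw m p (n + N))
      (fun w => ‖windowSum m (window h k R) 0 w t‖ ^ 2) := fun t => by
    rw [← mean_const hfin (0 : ℝ)]
    exact mean_mono hfin fun w _ => by positivity
  unfold energy
  rw [← mean_integral hfin _ fun w => integrable_windowSum hm hg 0 w,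
    ← setIntegral_eq_integral_of_forall_compl_eq_zero hzero]
  have h2 := norm_setIntegral_le_of_norm_le_const (μ := volume)
      (s := Set.Icc (-R) (lam m ^ (n + N))) (f := fun t => mean (wordLaw m p (n + N))
        (fun w => ‖windowSum m (window h k R) 0 w t‖ ^ 2)) (C := ε) (by simp) fun t _ => by
        rw [Real.norm_of_nonneg (hnn t)]
        exact hle t
  refine (le_abs_self _).trans (h2.trans ?_)
  have hpow : 0 < lam m ^ (n + N) := by positivity
  rw [Real.volume_real_Icc_of_le (by linarith), sub_neg_eq_add, add_comm R]

/-- The mean energy per tile in the law of the bi-infinite words tends to zero as the window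
grows. -/
theorem eventually_integral_headEnergy_le (hm : 1 ≤ m) {k : ℝ} (hk : k ∉ fourierModule m)
    {h : ℝ → ℝ} (hh : IsProfile h) (hμ : IsNobleMeansLaw m p μ) {ε : ℝ} (hε : 0 < ε) :
    ∀ᶠ R : ℝ in atTop, ∀ D : ℕ, lam m + R + 1 ≤ D → ∀ t : ℤ,
      ∫ x, headEnergy m (window h k R) (subword x t D) ∂μ ≤ ε := by
  have := hμ.1
  have h0 := lam_pos hm
  obtain ⟨N, hN⟩ := exists_level_mean_energy_le (p := p) hm hk hh (div_pos hε h0)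
  filter_upwards [hN, eventually_gt_atTop 0] with R hR hR0 D hD t
  have hg := isWindow_window (k := k) hh hR0
  set F := headEnergy m (window h k R) with hF
  have hlim : Tendsto (fun n => ∑ v : Fin D → Letter, F (List.ofFn v) *
      (mean (wordLaw m p n) (fun w => (occurrences (List.ofFn v) w : ℝ)) /
        mean (wordLaw m p n) (fun w => (w.length : ℝ)))) atTop
      (𝓝 (∫ x, F (subword x t D) ∂μ)) := by
    rw [integral_comp_subword]
    exact tendsto_finsetSum _ fun v _ => (hμ.2 t (List.ofFn v)).const_mul _
  have hlim' := hlim.comp (tendsto_add_atTop_nat N)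
  have hbd : Tendsto (fun n : ℕ => ε * (R * (lam m ^ (n + N))⁻¹ + 1)) atTop (𝓝 ε) := by
    have h1 : Tendsto (fun n : ℕ => (lam m ^ (n + N))⁻¹) atTop (𝓝 0) :=
      (tendsto_inv_atTop_zero.comp (tendsto_pow_atTop_atTop_of_one_lt (one_lt_lam hm))).comp
        (tendsto_add_atTop_nat N)
    simpa using ((h1.const_mul R).add_const 1).const_mul ε
  refine le_of_tendsto_of_tendsto' hlim' hbd fun n => ?_
  have hfin := support_wordLaw_finite (m := m) (p := p) (n + N)
  have hlen : lam m ^ (n + N) / lam m ≤ mean (wordLaw m p (n + N)) (fun w => (w.length : ℝ)) := by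
    rw [← mean_const hfin (lam m ^ (n + N) / lam m)]
    refine mean_mono hfin fun w hw => ?_
    rw [div_le_iff₀' h0, ← patchLength_of_mem_support_wordLaw hw]
    exact patchLength_le hm w
  have hpow : 0 < lam m ^ (n + N) := by positivity
  have hlen0 : 0 < mean (wordLaw m p (n + N)) (fun w => (w.length : ℝ)) :=
    (by positivity : 0 < lam m ^ (n + N) / lam m).trans_le hlen
  have hsum : ∑ v : Fin D → Letter, F (List.ofFn v) *
      mean (wordLaw m p (n + N)) (fun w => (occurrences (List.ofFn v) w : ℝ))
      ≤ ε / lam m * (R + lam m ^ (n + N)) := by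
    refine le_trans ?_ (hR n)
    simp only [← mean_const_mul_real hfin]
    rw [← mean_finset_sum hfin]
    refine mean_mono hfin fun w _ => ?_
    refine (sum_mul_occurrences_le (fun v => headEnergy_nonneg v) D w).trans ?_
    simp only [headEnergy_take hm hg hD]
    exact sum_headEnergy_le_energy hm hg w
  simp only [Function.comp_apply, ← mul_div_assoc, ← Finset.sum_div]
  rw [div_le_iff₀ hlen0]
  refine hsum.trans ?_
  calc ε / lam m * (R + lam m ^ (n + N))
      = ε * (R * (lam m ^ (n + N))⁻¹ + 1) * (lam m ^ (n + N) / lam m) := by field_simp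
    _ ≤ _ := by gcongr

end Law

/-! ### The maximal ergodic inequality -/

section Maximal

variable {X : Type*} {T : X → X}

/-- The maximum of `0` and the first `N` Birkhoff sums of `f`. -/
def maxSum (T : X → X) (f : X → ℝ) : ℕ → X → ℝ
  | 0, _ => 0
  | N + 1, x => max 0 (f x + maxSum T f N (T x))

theorem maxSum_nonneg (f : X → ℝ) (N : ℕ) (x : X) : 0 ≤ maxSum T f N x := by
  cases N with
  | zero => exact le_rfl
  | succ N => exact le_max_left _ _

theorem maxSum_le_succ (f : X → ℝ) (N : ℕ) (x : X) :
    maxSum T f N x ≤ maxSum T f (N + 1) x := by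
  induction N generalizing x with
  | zero => exact maxSum_nonneg f 1 x
  | succ N ih => exact max_le_max le_rfl (by linarith [ih (T x)])

theorem sum_iterate_le_maxSum (f : X → ℝ) (N : ℕ) (x : X) :
    ∑ j ∈ Finset.range N, f (T^[j] x) ≤ maxSum T f N x := by
  induction N generalizing x with
  | zero => simp [maxSum]
  | succ N ih =>
    rw [Finset.sum_range_succ']
    refine le_max_of_le_right ?_
    have := ih (T x)
    simp only [Function.iterate_succ_apply, Function.iterate_zero, id]
    linarith

variable [MeasurableSpace X] {μ : Measure X}

theorem measurable_maxSum (hT : Measurable T) {f : X → ℝ} (hf : Measurable f) (N : ℕ) :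
    Measurable (maxSum T f N) := by
  induction N with
  | zero => exact measurable_const
  | succ N ih => exact measurable_const.max (hf.add (ih.comp hT))

theorem integrable_maxSum (hT : MeasurePreserving T μ μ) {f : X → ℝ} (hf : Integrable f μ)
    (N : ℕ) : Integrable (maxSum T f N) μ := by
  induction N with
  | zero => exact integrable_zero _ _ _
  | succ N ih =>
    exact (integrable_zero _ _ _).sup (hf.add (hT.integrable_comp_of_integrable ih))

/-- The maximal ergodic inequality, with Garsia's proof: on the set where the maximum `M` of the
Birkhoff sums of `F - c` is positive, `F - c` is at least `M - M ∘ T`, whose integral vanishes. -/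
theorem mul_measureReal_maxSum_pos_le [IsProbabilityMeasure μ] (hT : MeasurePreserving T μ μ)
    {F : X → ℝ} (hFm : Measurable F) (hF : Integrable F μ) (hF0 : ∀ x, 0 ≤ F x) (c : ℝ) (N : ℕ) :
    c * μ.real {x | 0 < maxSum T (fun x => F x - c) N x} ≤ ∫ x, F x ∂μ := by
  set f : X → ℝ := fun x => F x - c with hf
  have hfm : Measurable f := hFm.sub_const c
  have hfi : Integrable f μ := hF.sub (integrable_const c)
  set M := maxSum T f N with hM
  have hMm : Measurable M := measurable_maxSum hT.measurable hfm N
  have hMi : Integrable M μ := integrable_maxSum hT hfi N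
  have hMTi : Integrable (fun x => M (T x)) μ := hT.integrable_comp_of_integrable hMi
  set E := {x | 0 < M x} with hE
  have hEm : MeasurableSet E := measurableSet_lt measurable_const hMm
  have hpt : ∀ x, M x - M (T x) ≤ E.indicator f x := by
    intro x
    have hMT : 0 ≤ M (T x) := maxSum_nonneg f N _
    by_cases hx : x ∈ E
    · rw [Set.indicator_of_mem hx]
      have h1 : M x ≤ maxSum T f (N + 1) x := maxSum_le_succ f N x
      rw [maxSum] at h1
      have h2 : (0 : ℝ) < M x := hx
      rcases le_max_iff.1 h1 with h3 | h3
      · linarith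
      · linarith
    · rw [Set.indicator_of_notMem hx]
      have : ¬ 0 < M x := hx
      linarith
  have hint : ∫ x, M x - M (T x) ∂μ = 0 := by
    rw [integral_sub hMi hMTi, sub_eq_zero]
    have := integral_map (μ := μ) (φ := T) (f := M) hT.measurable.aemeasurable
      hMm.aestronglyMeasurable
    rw [← this, hT.map_eq]
  have h1 : 0 ≤ ∫ x in E, f x ∂μ := by
    rw [← hint, ← integral_indicator hEm]
    exact integral_mono (hMi.sub hMTi) (hfi.indicator hEm) hpt
  have h2 : ∫ x in E, f x ∂μ = ∫ x in E, F x ∂μ - c * μ.real E := by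
    rw [hf, integral_sub hF.integrableOn integrableOn_const, setIntegral_const, smul_eq_mul,
      mul_comm]
  have h3 : ∫ x in E, F x ∂μ ≤ ∫ x, F x ∂μ :=
    setIntegral_le_integral hF (Eventually.of_forall hF0)
  linarith

theorem measure_exists_sum_gt_le [IsProbabilityMeasure μ] (hT : MeasurePreserving T μ μ)
    {F : X → ℝ} (hFm : Measurable F) (hF : Integrable F μ) (hF0 : ∀ x, 0 ≤ F x) {c : ℝ}
    (hc : 0 < c) :
    μ {x | ∃ n : ℕ, c * n < ∑ j ∈ Finset.range n, F (T^[j] x)}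
      ≤ ENNReal.ofReal ((∫ x, F x ∂μ) / c) := by
  set f : X → ℝ := fun x => F x - c with hf
  have hmono : Monotone fun N => {x | 0 < maxSum T f N x} := by
    refine monotone_nat_of_le_succ fun N x hx => ?_
    have hx : 0 < maxSum T f N x := hx
    exact hx.trans_le (maxSum_le_succ f N x)
  calc _ ≤ μ (⋃ N, {x | 0 < maxSum T f N x}) := by
        refine measure_mono fun x hx => ?_
        obtain ⟨n, hn⟩ := hx
        refine Set.mem_iUnion.2 ⟨n, ?_⟩
        refine lt_of_lt_of_le ?_ (sum_iterate_le_maxSum f n x)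
        simp only [hf, Finset.sum_sub_distrib, Finset.sum_const, Finset.card_range, nsmul_eq_mul]
        linarith
    _ = ⨆ N, μ {x | 0 < maxSum T f N x} := hmono.measure_iUnion
    _ ≤ _ := by
        refine iSup_le fun N => ?_
        rw [← ofReal_measureReal]
        refine ENNReal.ofReal_le_ofReal ?_
        rw [le_div_iff₀' hc]
        exact mul_measureReal_maxSum_pos_le hT hFm hF hF0 c N

end Maximal

/-! ### Invariance under the shift -/

/-- The translation of the bi-infinite words by `d` positions. -/
def shift (d : ℤ) (x : ℤ → Letter) : ℤ → Letter := fun i => x (i + d)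

theorem measurable_shift (d : ℤ) : Measurable (shift d) :=
  measurable_pi_lambda _ fun _ => measurable_pi_apply _

theorem iterate_shift (d : ℤ) (j : ℕ) (x : ℤ → Letter) : (shift d)^[j] x = shift (j * d) x := by
  induction j generalizing x with
  | zero =>
    funext i
    simp [shift]
  | succ j ih =>
    rw [Function.iterate_succ_apply, ih]
    funext i
    simp only [shift]
    congr 1
    push_cast
    ring

theorem subword_shift (d : ℤ) (x : ℤ → Letter) (t : ℤ) (D : ℕ) :
    subword (shift d x) t D = subword x (t + d) D := by
  simp only [subword, shift]
  congr 1
  funext i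
  congr 1
  ring

theorem measurePreserving_shift {m : ℕ} {p : PMF (Fin (m + 1))} {μ : Measure (ℤ → Letter)}
    (hμ : IsNobleMeansLaw m p μ) (d : ℤ) : MeasurePreserving (shift d) μ μ := by
  have := hμ.1
  refine ⟨measurable_shift d, ?_⟩
  have hmap : IsProbabilityMeasure (μ.map (shift d)) :=
    Measure.isProbabilityMeasure_map (measurable_shift d).aemeasurable
  have hfreq : ∀ (t : ℤ) (v : List Letter), μ.real (cylinder (t + d) v) = μ.real (cylinder t v) :=
    fun t v => tendsto_nhds_unique (hμ.2 (t + d) v) (hμ.2 t v)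
  refine IsProjectiveLimit.unique (P := fun I : Finset ℤ => μ.map I.restrict) (fun I => ?_)
    fun I => rfl
  rw [Measure.map_map (Finset.measurable_restrict I) (measurable_shift d)]
  have : IsProbabilityMeasure (μ.map (I.restrict ∘ shift d)) :=
    Measure.isProbabilityMeasure_map
      ((Finset.measurable_restrict I).comp (measurable_shift d)).aemeasurable
  have : IsProbabilityMeasure (μ.map (I.restrict (π := fun _ : ℤ => Letter))) :=
    Measure.isProbabilityMeasure_map (Finset.measurable_restrict I).aemeasurable
  refine Measure.ext_of_measureReal_singleton fun y => ?_
  -- The finite index set lies in an interval, so the event is a union of cylinder sets.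
  obtain ⟨n, hn⟩ : ∃ n : ℕ, ∀ i ∈ I, -(n : ℤ) ≤ i ∧ i < n := by
    refine ⟨∑ i ∈ I, (i.natAbs + 1), fun i hi => ?_⟩
    have := Finset.single_le_sum (f := fun i : ℤ => i.natAbs + 1) (fun _ _ => Nat.zero_le _) hi
    omega
  classical
  set H : List Letter → ℝ := fun l =>
    if ∀ i : I, l[((i : ℤ) + n).toNat]? = some (y i) then 1 else 0 with hH
  set A : Set (ℤ → Letter) := I.restrict ⁻¹' {y} with hA
  have hAm : MeasurableSet A := Finset.measurable_restrict I (measurableSet_singleton y)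
  have hHA : ∀ x, H (subword x (-n) (2 * n)) = A.indicator (fun _ => (1 : ℝ)) x := by
    intro x
    have hiff : (∀ i : I, (subword x (-n) (2 * n))[((i : ℤ) + n).toNat]? = some (y i))
        ↔ x ∈ A := by
      rw [hA, Set.mem_preimage, Set.mem_singleton_iff, funext_iff]
      refine forall_congr' fun i => ?_
      have hi := hn i i.2
      have hlt : ((i : ℤ) + n).toNat < 2 * n := by omega
      have hidx : -(n : ℤ) + (((i : ℤ) + n).toNat : ℤ) = i := by omega
      rw [subword, List.getElem?_ofFn, dif_pos hlt]
      simp only [Option.some.injEq, hidx, Finset.restrict]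
    simp only [hH, hiff, Set.indicator]
  have hint : ∀ d : ℤ, μ.real (shift d ⁻¹' A) = ∫ x, H (subword x (-n + d) (2 * n)) ∂μ := by
    intro d
    simp only [← subword_shift, hHA]
    have h1 : ∀ x, A.indicator (fun _ => (1 : ℝ)) (shift d x)
        = (shift d ⁻¹' A).indicator (fun _ => (1 : ℝ)) x := fun x => rfl
    simp only [h1]
    rw [integral_indicator_const _ (measurable_shift d hAm), smul_eq_mul, mul_one]
  have hA0 : A = shift 0 ⁻¹' A := by
    have : shift 0 = id := by
      funext x i
      simp [shift]
    rw [this, Set.preimage_id]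
  rw [map_measureReal_apply ((Finset.measurable_restrict I).comp (measurable_shift d))
    (measurableSet_singleton y), map_measureReal_apply (Finset.measurable_restrict I)
    (measurableSet_singleton y), Set.preimage_comp, ← hA]
  conv_rhs => rw [hA0]
  rw [hint, hint, integral_comp_subword, integral_comp_subword]
  simp only [hfreq, add_zero]

/-! ### Almost sure smallness of the local energies -/

/-- The bi-infinite words with the property that, for every `ε > 0`, some window has a mean local
energy of at most `ε` over all initial ranges of positions, to the right and to the left of the
origin. The local energy at a position is read off from `D` letters, which cover the window. -/
def SmallEnergies (m : ℕ) (h : ℝ → ℝ) (k : ℝ) (x : ℤ → Letter) : Prop :=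
  ∀ ε > 0, ∃ (R : ℝ) (D : ℕ), 0 < R ∧ lam m + R + 1 ≤ D ∧ ∀ n : ℕ,
    ∑ j ∈ Finset.range n, headEnergy m (window h k R) (subword x j D) ≤ ε * n ∧
      ∑ j ∈ Finset.range n, headEnergy m (window h k R) (subword x (-j) D) ≤ ε * n

/-- The maximal inequality, applied to a sequence of windows whose mean energies are summable,
combined with the Borel-Cantelli lemma. -/
theorem ae_smallEnergies {m : ℕ} (hm : 1 ≤ m) {p : PMF (Fin (m + 1))} {μ : Measure (ℤ → Letter)}
    (hμ : IsNobleMeansLaw m p μ) {k : ℝ} (hk : k ∉ fourierModule m) {h : ℝ → ℝ}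
    (hh : IsProfile h) : ∀ᵐ x ∂μ, SmallEnergies m h k x := by
  have := hμ.1
  -- The bound `4⁻ⁱ` on the integral makes the exceptional set for the threshold `2⁻ⁱ` have measure
  -- at most `2⁻ⁱ`.
  have hex : ∀ i : ℕ, ∃ (R : ℝ) (D : ℕ), 0 < R ∧ lam m + R + 1 ≤ D ∧
      ∫ x, headEnergy m (window h k R) (subword x 0 D) ∂μ ≤ (1 / 2) ^ i * (1 / 2) ^ i := by
    intro i
    obtain ⟨R, hR, hR0⟩ := ((eventually_integral_headEnergy_le hm hk hh hμ
      (ε := (1 / 2) ^ i * (1 / 2) ^ i) (by positivity)).and (eventually_gt_atTop 0)).exists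
    obtain ⟨D, hD⟩ := exists_nat_ge (lam m + R + 1)
    exact ⟨R, D, hR0, hD, hR D hD 0⟩
  choose R D hR hD hint using hex
  set F : ℕ → (ℤ → Letter) → ℝ := fun i x => headEnergy m (window h k (R i)) (subword x 0 (D i))
    with hF
  have hsummable : ∑' i : ℕ, ENNReal.ofReal ((1 / 2) ^ i) ≠ ⊤ := by
    rw [← ENNReal.ofReal_tsum_of_nonneg (fun i => by positivity) summable_geometric_two]
    exact ENNReal.ofReal_ne_top
  have hmax : ∀ d : ℤ, ∀ᵐ x ∂μ, ∀ᶠ i in atTop, x ∉ {x | ∃ n : ℕ, (1 / 2) ^ i * (n : ℝ)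
      < ∑ j ∈ Finset.range n, F i ((shift d)^[j] x)} := by
    intro d
    refine ae_eventually_notMem (ne_top_of_le_ne_top hsummable (ENNReal.tsum_le_tsum fun i => ?_))
    refine (measure_exists_sum_gt_le (measurePreserving_shift hμ d)
      (measurable_comp_subword _ 0 (D i)) (integrable_comp_subword μ
        (C := lam m * ((R i)⁻¹ * (R i + 1)) ^ 2) (fun v => ?_) 0 (D i))
      (fun x => headEnergy_nonneg _) (by positivity)).trans (ENNReal.ofReal_le_ofReal ?_)
    · rw [abs_of_nonneg (headEnergy_nonneg v)]
      exact headEnergy_le hm (isWindow_window hh (hR i)) v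
    · rw [div_le_iff₀ (by positivity)]
      exact hint i
  filter_upwards [hmax 1, hmax (-1)] with x hx1 hx2 ε hε
  have hsmall : ∀ᶠ i : ℕ in atTop, ((1 / 2 : ℝ)) ^ i < ε :=
    (tendsto_pow_atTop_nhds_zero_of_lt_one (by norm_num) (by norm_num)).eventually_lt_const hε
  obtain ⟨i, hi1, hi2, hi3⟩ := (hx1.and (hx2.and hsmall)).exists
  refine ⟨R i, D i, hR i, hD i, fun n => ?_⟩
  have hconv : ∀ (d : ℤ) (j : ℕ), F i ((shift d)^[j] x)
      = headEnergy m (window h k (R i)) (subword x (j * d) (D i)) := fun d j => by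
    simp only [hF, iterate_shift, subword_shift, zero_add]
  simp only [not_exists, not_lt, hconv] at hi1 hi2
  have hn : (1 / 2 : ℝ) ^ i * n ≤ ε * n := by gcongr
  constructor
  · have := (hi1 n).trans hn
    simpa only [mul_one] using this
  · have := (hi2 n).trans hn
    simpa only [mul_neg, mul_one] using this

/-! ### The points of a tiling of the line -/

section Tiling

variable {m : ℕ} (x : ℤ → Letter)

theorem tilingPoint_zero : tilingPoint m x 0 = 0 := by simp [tilingPoint]

theorem tilingPoint_succ (j : ℤ) :
    tilingPoint m x (j + 1) = tilingPoint m x j + tileLength m (x j) := by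
  unfold tilingPoint
  rcases le_or_gt 0 j with hj | hj
  · rw [Finset.Ico_eq_empty (a := j) (by omega), Finset.Ico_eq_empty (a := j + 1) (by omega),
      ← Finset.insert_Ico_right_eq_Ico_add_one hj, Finset.sum_insert (by simp)]
    ring
  · rw [Finset.Ico_eq_empty (b := j) (by omega), Finset.Ico_eq_empty (b := j + 1) (by omega),
      ← Finset.insert_Ico_add_one_left_eq_Ico hj, Finset.sum_insert (by simp)]
    ring

theorem strictMono_tilingPoint (hm : 1 ≤ m) : StrictMono (tilingPoint m x) :=
  strictMono_int_of_lt_succ fun j => by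
    rw [tilingPoint_succ]
    linarith [one_le_tileLength hm (x j)]

theorem natCast_le_tilingPoint (hm : 1 ≤ m) (n : ℕ) : (n : ℝ) ≤ tilingPoint m x n := by
  induction n with
  | zero => simp [tilingPoint_zero]
  | succ n ih =>
    push_cast
    rw [tilingPoint_succ]
    linarith [one_le_tileLength hm (x n)]

theorem tilingPoint_neg_le (hm : 1 ≤ m) (n : ℕ) : tilingPoint m x (-n) ≤ -n := by
  induction n with
  | zero => simp [tilingPoint_zero]
  | succ n ih =>
    have h := tilingPoint_succ (m := m) x (-(n + 1 : ℕ))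
    rw [show -((n + 1 : ℕ) : ℤ) + 1 = -n by push_cast; ring] at h
    have := one_le_tileLength hm (x (-(n + 1 : ℕ)))
    push_cast at h this ⊢
    linarith

/-- The points of the tiling in a symmetric interval are the points of a patch. -/
theorem exists_pointSet_inter_closedBall (hm : 1 ≤ m) (n : ℕ) : ∃ (α : ℤ) (N : ℕ),
    -(n : ℤ) ≤ α ∧ α + N ≤ n + 1 ∧ pointSet m x ∩ Metric.closedBall 0 n
      = (Finset.range N).image fun i : ℕ => tilingPoint m x (α + i) := by
  have hmono := strictMono_tilingPoint x hm
  set J := {j ∈ Finset.Icc (-(n : ℤ)) n | |tilingPoint m x j| ≤ n} with hJ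
  have hJmem : ∀ j, j ∈ J ↔ |tilingPoint m x j| ≤ n := by
    intro j
    rw [hJ, Finset.mem_filter, and_iff_right_iff_imp, Finset.mem_Icc]
    intro hj
    rw [abs_le] at hj
    constructor
    · by_contra hlt
      have h1 : tilingPoint m x j < tilingPoint m x (-n) := hmono (by omega)
      linarith [tilingPoint_neg_le x hm n, hj.1]
    · by_contra hlt
      have h1 : tilingPoint m x n < tilingPoint m x j := hmono (by omega)
      linarith [natCast_le_tilingPoint x hm n, hj.2]
  have hne : J.Nonempty := ⟨0, by rw [hJmem, tilingPoint_zero, abs_zero]; positivity⟩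
  set α := J.min' hne with hα
  set β := J.max' hne with hβ
  have hαmem := J.min'_mem hne
  have hβmem := J.max'_mem hne
  have hαβ : α ≤ β := J.min'_le _ hβmem
  have hα1 := (Finset.mem_Icc.1 (Finset.mem_filter.1 hαmem).1).1
  have hβ1 := (Finset.mem_Icc.1 (Finset.mem_filter.1 hβmem).1).2
  refine ⟨α, (β + 1 - α).toNat, hα1, by omega, ?_⟩
  ext y
  simp only [pointSet, Set.mem_inter_iff, Set.mem_range, mem_closedBall_zero_iff,
    Real.norm_eq_abs, Finset.coe_image, Set.mem_image, Finset.coe_range, Set.mem_Iio]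
  constructor
  · rintro ⟨⟨j, rfl⟩, hj⟩
    have hjJ := (hJmem j).2 hj
    have h1 : α ≤ j := J.min'_le _ hjJ
    have h2 : j ≤ β := J.le_max' _ hjJ
    refine ⟨(j - α).toNat, by omega, ?_⟩
    congr 1
    omega
  · rintro ⟨i, hi, rfl⟩
    refine ⟨⟨_, rfl⟩, ?_⟩
    have h1 := abs_le.1 ((hJmem α).1 hαmem)
    have h2 := abs_le.1 ((hJmem β).1 hβmem)
    have h3 := hmono.monotone (show α ≤ α + i by omega)
    have h4 := hmono.monotone (show α + i ≤ β by omega)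
    exact abs_le.2 ⟨by linarith, by linarith⟩

theorem subword_succ (t : ℤ) (N : ℕ) : subword x t (N + 1) = x t :: subword x (t + 1) N := by
  simp only [subword, List.ofFn_succ]
  congr 2
  · simp
  · funext i
    congr 1
    push_cast [Fin.val_succ]
    ring

theorem length_subword (t : ℤ) (N : ℕ) : (subword x t N).length = N := by simp [subword]

theorem drop_subword (t : ℤ) (N i : ℕ) :
    (subword x t N).drop i = subword x (t + i) (N - i) := by
  induction i generalizing t N with
  | zero => simp
  | succ i ih =>
    cases N with
    | zero => simp [subword]
    | succ N =>
      rw [subword_succ, List.drop_succ_cons, ih, Nat.succ_sub_succ]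
      congr 1
      push_cast
      ring

theorem take_subword (t : ℤ) {N D : ℕ} (h : D ≤ N) :
    (subword x t N).take D = subword x t D := by
  induction D generalizing t N with
  | zero => simp [subword]
  | succ D ih =>
    obtain ⟨N, rfl⟩ := Nat.exists_eq_succ_of_ne_zero (by omega : N ≠ 0)
    rw [Nat.succ_eq_add_one, subword_succ, subword_succ, List.take_succ_cons, ih _ (by omega)]

theorem patchSum_subword (f : ℝ → ℂ) (t : ℤ) (N : ℕ) :
    patchSum m f (tilingPoint m x t) (subword x t N)
      = ∑ i ∈ Finset.range N, f (tilingPoint m x (t + i)) := by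
  induction N generalizing t with
  | zero => simp [subword]
  | succ N ih =>
    rw [subword_succ, patchSum_cons, ← tilingPoint_succ, ih, Finset.sum_range_succ', add_comm]
    congr 1
    · refine Finset.sum_congr rfl fun i _ => ?_
      congr 2
      push_cast
      ring
    · simp

end Tiling

section EnergyBound

variable {m : ℕ} {g : ℝ → ℂ} {R B : ℝ}

theorem sum_range_ite_le {C : ℝ} (hC : 0 ≤ C) (N D : ℕ) :
    ∑ i ∈ Finset.range N, (if N < i + D then C else 0) ≤ D * C := by
  rw [← Finset.sum_filter, Finset.sum_const, nsmul_eq_mul]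
  gcongr
  refine (Finset.card_le_card (t := Finset.Ico (N - D) N) fun i hi => ?_).trans (by
    rw [Nat.card_Ico]
    omega)
  rw [Finset.mem_filter, Finset.mem_range] at hi
  rw [Finset.mem_Ico]
  omega

theorem sum_shift_range_le {f : ℤ → ℝ} (hf : ∀ j, 0 ≤ f j) {n N : ℕ} {α : ℤ}
    (hα : -(n : ℤ) ≤ α) (hN : α + N ≤ n + 1) :
    ∑ i ∈ Finset.range N, f (α + i) ≤ ∑ j ∈ Finset.range (n + 1), f j
      + ∑ j ∈ Finset.range (n + 1), f (-j) := by
  classical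
  set s₁ : Finset ℤ := (Finset.range (n + 1)).image fun j : ℕ => (j : ℤ) with hs₁
  set s₂ : Finset ℤ := (Finset.range (n + 1)).image fun j : ℕ => -(j : ℤ) with hs₂
  have h1 : ∑ j ∈ s₁, f j = ∑ j ∈ Finset.range (n + 1), f j :=
    Finset.sum_image fun a _ b _ h => by simpa using h
  have h2 : ∑ j ∈ s₂, f j = ∑ j ∈ Finset.range (n + 1), f (-j) :=
    Finset.sum_image fun a _ b _ h => by simpa using h
  have h3 : ∑ j ∈ (Finset.range N).image (fun i : ℕ => α + i), f j
      = ∑ i ∈ Finset.range N, f (α + i) :=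
    Finset.sum_image fun a _ b _ h => by simpa using h
  rw [← h1, ← h2, ← h3, ← Finset.sum_union_inter]
  refine le_add_of_le_of_nonneg (Finset.sum_le_sum_of_subset_of_nonneg ?_ fun j _ _ => hf j)
    (Finset.sum_nonneg fun j _ => hf j)
  intro j hj
  obtain ⟨i, hi, rfl⟩ := Finset.mem_image.1 hj
  have hi := Finset.mem_range.1 hi
  rw [Finset.mem_union, Finset.mem_image, Finset.mem_image]
  rcases le_or_gt 0 (α + i) with h | h
  · exact Or.inl ⟨(α + i).toNat, by rw [Finset.mem_range]; omega, by omega⟩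
  · exact Or.inr ⟨(-(α + i)).toNat, by rw [Finset.mem_range]; omega, by omega⟩

/-- The energy of a patch of a tiling is the sum of the energies seen from its tiles, up to a
boundary term that does not depend on the patch. -/
theorem energy_subword_le (hm : 1 ≤ m) (hg : IsWindow g R B) {D : ℕ} (hD : lam m + R + 1 ≤ D)
    (x : ℤ → Letter) (α : ℤ) (N : ℕ) :
    energy m g (subword x α N)
      ≤ ∑ i ∈ Finset.range N, headEnergy m g (subword x (α + i) D)
        + (D * (lam m * (B * (R + 1)) ^ 2) + R * (B * (R + 1)) ^ 2) := by
  have h0 := lam_pos hm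
  have hC : 0 ≤ lam m * (B * (R + 1)) ^ 2 := by positivity
  refine (energy_le hm hg _).trans ?_
  rw [← add_assoc]
  gcongr
  refine le_trans ?_ (add_le_add_right (sum_range_ite_le hC N D) _)
  rw [length_subword, ← Finset.sum_add_distrib]
  refine Finset.sum_le_sum fun i _ => ?_
  rw [drop_subword]
  split_ifs with h
  · exact le_add_of_nonneg_of_le (headEnergy_nonneg _) (headEnergy_le hm hg _)
  · rw [← headEnergy_take hm hg hD, take_subword _ _ (by omega), add_zero]

theorem integral_norm_sq_windowSum (s : ℝ) (w : List Letter) :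
    ∫ t, ‖windowSum m g s w t‖ ^ 2 = energy m g w := by
  rw [energy, ← integral_sub_right_eq_self (fun t => ‖windowSum m g 0 w t‖ ^ 2) s]
  congr 1
  funext t
  rw [← windowSum_add, zero_add]

end EnergyBound

/-! ### Autocorrelation and the spectral mass of a point -/

section Fourier

variable {h : ℝ → ℝ} {k R : ℝ}

theorem hasCompactSupport_window (hh : IsProfile h) (hR : 0 < R) :
    HasCompactSupport (window h k R) :=
  HasCompactSupport.intro isCompact_Icc fun _ => window_eq_zero hh hR

/-- The window as a Schwartz function. -/
def schwartzWindow (hh : IsProfile h) (k : ℝ) (hR : 0 < R) : 𝓢(ℝ, ℂ) :=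
  (hasCompactSupport_window (k := k) hh hR).toSchwartzMap (contDiff_window hh)

theorem schwartzWindow_apply (hh : IsProfile h) (hR : 0 < R) (t : ℝ) :
    schwartzWindow hh k hR t = window h k R t := rfl

/-- The squared modulus of the Fourier transform of a Schwartz function, as a Schwartz function. -/
def spectralSquare (G : 𝓢(ℝ, ℂ)) : 𝓢(ℝ, ℂ) :=
  SchwartzMap.pairing (ContinuousLinearMap.mul ℝ ℂ) (𝓕 G)
    (SchwartzMap.postcompCLM (Complex.conjCLE : ℂ →L[ℝ] ℂ) (𝓕 G))

theorem spectralSquare_apply (G : 𝓢(ℝ, ℂ)) (t : ℝ) :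
    spectralSquare G t = ((‖(𝓕 G) t‖ ^ 2 : ℝ) : ℂ) := by
  rw [spectralSquare, SchwartzMap.pairing_apply_apply, SchwartzMap.postcompCLM_apply]
  simp [Complex.mul_conj, Complex.normSq_eq_norm_sq]

theorem fourier_compSubConst (G : 𝓢(ℝ, ℂ)) (y t : ℝ) :
    (𝓕 (SchwartzMap.compSubConstCLM ℂ y G)) t = wave y t * (𝓕 G) t := by
  rw [SchwartzMap.fourier_coe, SchwartzMap.fourier_coe, Real.fourier_real_eq_integral_exp_smul,
    Real.fourier_real_eq_integral_exp_smul, ← integral_const_mul,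
    ← integral_add_right_eq_self _ y]
  congr 1
  funext v
  rw [SchwartzMap.compSubConstCLM_apply, add_sub_cancel_right, smul_eq_mul, smul_eq_mul,
    ← mul_assoc, wave, ← Complex.exp_add]
  congr 2
  push_cast
  ring

/-- By Plancherel's theorem, the Fourier transform of the squared modulus of `𝓕 G` is the
autocorrelation function of `G`. -/
theorem fourier_spectralSquare (G : 𝓢(ℝ, ℂ)) (y : ℝ) :
    (𝓕 (spectralSquare G)) y = ∫ t, G (t - y) * (starRingEnd ℂ) (G t) := by
  have h1 := SchwartzMap.integral_inner_fourier_fourier G (SchwartzMap.compSubConstCLM ℂ y G)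
  simp only [RCLike.inner_apply, SchwartzMap.compSubConstCLM_apply] at h1
  rw [← h1, SchwartzMap.fourier_coe, Real.fourier_real_eq_integral_exp_smul]
  congr 1
  funext t
  rw [fourier_compSubConst, spectralSquare_apply, smul_eq_mul, mul_assoc (wave y t),
    Complex.mul_conj, Complex.normSq_eq_norm_sq, wave]
  congr 2
  push_cast
  ring

theorem fourier_window (hh : IsProfile h) (hR : 0 < R) :
    (𝓕 (schwartzWindow hh k hR)) k = ((∫ t, h t : ℝ) : ℂ) := by
  rw [SchwartzMap.fourier_coe, Real.fourier_real_eq_integral_exp_smul]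
  have h1 : ∀ v : ℝ, Complex.exp (((-2 * Real.pi * v * k : ℝ) : ℂ) * Complex.I) •
      schwartzWindow hh k hR v = ((h (v / R) / R : ℝ) : ℂ) := by
    intro v
    rw [schwartzWindow_apply, window, smul_eq_mul, mul_left_comm, wave, ← Complex.exp_add]
    rw [show ((-2 * Real.pi * v * k : ℝ) : ℂ) * Complex.I
      + -2 * Real.pi * Complex.I * ((-k : ℝ) : ℂ) * v = 0 by push_cast; ring, Complex.exp_zero,
      mul_one]
  simp only [h1]
  rw [integral_complex_ofReal, integral_div, Measure.integral_comp_div, abs_of_pos hR,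
    smul_eq_mul, mul_div_cancel_left₀ _ hR.ne']

theorem hasCompactSupport_fourier_spectralSquare (hh : IsProfile h) (hR : 0 < R) :
    HasCompactSupport fun y => ((𝓕 (spectralSquare (schwartzWindow hh k hR))) y).re := by
  refine HasCompactSupport.intro (isCompact_Icc (a := -R) (b := R)) fun y hy => ?_
  rw [fourier_spectralSquare, integral_eq_zero_of_ae, Complex.zero_re]
  refine Eventually.of_forall fun t => ?_
  simp only [schwartzWindow_apply, Pi.zero_apply, mul_eq_zero, map_eq_zero]
  by_contra hcon
  push Not at hcon
  have h1 : t - y ∈ Set.Icc (-R) 0 := by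
    by_contra h
    exact hcon.1 (window_eq_zero hh hR h)
  have h2 : t ∈ Set.Icc (-R) 0 := by
    by_contra h
    exact hcon.2 (window_eq_zero hh hR h)
  exact hy ⟨by linarith [h1.2, h2.1], by linarith [h1.1, h2.2]⟩

theorem sum_sum_fourier_spectralSquare (hh : IsProfile h) (hR : 0 < R) {ι : Type*}
    (s : Finset ι) (z : ι → ℝ) :
    ∑ i ∈ s, ∑ j ∈ s, (𝓕 (spectralSquare (schwartzWindow hh k hR))) (z i - z j)
      = ((∫ t, ‖∑ i ∈ s, window h k R (t - z i)‖ ^ 2 : ℝ) : ℂ) := by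
  have hg := (contDiff_window (k := k) (R := R) hh).continuous
  have hint : ∀ a b : ℝ, Integrable fun t =>
      window h k R (t - a) * (starRingEnd ℂ) (window h k R (t - b)) := by
    intro a b
    refine Continuous.integrable_of_hasCompactSupport (by fun_prop) ?_
    refine HasCompactSupport.mul_right ?_
    exact (hasCompactSupport_window hh hR).comp_homeomorph (Homeomorph.subRight a)
  have h1 : ∀ a b : ℝ, (𝓕 (spectralSquare (schwartzWindow hh k hR))) (a - b)
      = ∫ t, window h k R (t - a) * (starRingEnd ℂ) (window h k R (t - b)) := by
    intro a b
    rw [fourier_spectralSquare, ← integral_sub_right_eq_self _ b]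
    congr 1
    funext t
    simp only [schwartzWindow_apply]
    congr 2
    ring
  simp only [h1]
  rw [← integral_complex_ofReal]
  have h2 : ∀ t, ((‖∑ i ∈ s, window h k R (t - z i)‖ ^ 2 : ℝ) : ℂ)
      = ∑ i ∈ s, ∑ j ∈ s,
        window h k R (t - z i) * (starRingEnd ℂ) (window h k R (t - z j)) := by
    intro t
    rw [← Complex.normSq_eq_norm_sq, ← Complex.mul_conj, map_sum, Finset.sum_mul_sum]
  simp only [h2]
  rw [integral_finsetSum _ fun i _ => integrable_finsetSum _ fun j _ => hint _ _]
  refine Finset.sum_congr rfl fun i _ => ?_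
  rw [integral_finsetSum _ fun j _ => hint _ _]

end Fourier

theorem diracComb_finset (s : Finset ℝ) : diracComb s = ∑ x ∈ s, Measure.dirac x := by
  rw [diracComb, Measure.sum_fintype]
  exact Finset.sum_coe_sort s fun x => Measure.dirac x

theorem integral_diracComb_finset (s : Finset ℝ) (f : ℝ → ℝ) :
    ∫ y, f y ∂(diracComb s) = ∑ y ∈ s, f y := by
  rw [diracComb_finset, integral_finsetSum_measure fun y _ => integrable_dirac (by simp)]
  simp

theorem integral_finiteAutocorrelation {P : Set ℝ} {n : ℕ} {s : Finset ℝ}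
    (hs : P ∩ Metric.closedBall 0 n = s) {f : ℝ → ℝ} (hf : Continuous f)
    (hfc : HasCompactSupport f) :
    ∫ y, f y ∂(finiteAutocorrelation P n) = (2 * n : ℝ)⁻¹ * ∑ y ∈ s, ∑ z ∈ s, f (y - z) := by
  have hfin : IsFiniteMeasure (diracComb (s : Set ℝ)) := by
    rw [diracComb_finset]
    infer_instance
  obtain ⟨C, hC⟩ := hf.bounded_above_of_compact_support hfc
  rw [finiteAutocorrelation, hs, integral_smul_measure, Real.volume_closedBall,
    ENNReal.toReal_inv, ENNReal.toReal_ofReal (by positivity), smul_eq_mul]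
  congr 1
  have hneg : Measurable fun y : ℝ => -y := measurable_neg
  rw [integral_conv (Integrable.of_bound hf.aestronglyMeasurable C (Eventually.of_forall hC))]
  have h1 : ∀ y : ℝ, ∫ z, f (y + z) ∂((diracComb (s : Set ℝ)).map fun z => -z)
      = ∑ z ∈ s, f (y - z) := by
    intro y
    rw [integral_map hneg.aemeasurable (by fun_prop)]
    simp only [← sub_eq_add_neg]
    exact integral_diracComb_finset s _
  simp only [h1]
  exact integral_diracComb_finset s _

/-- If the local energies are small in the mean, then no diffraction measure charges `k`: the mass
of `k` is dominated by the integral of the spectral square of a long window, which by the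
definition of the autocorrelation is a limit of normalised energies. -/
theorem SmallEnergies.measure_singleton_eq_zero {m : ℕ} (hm : 1 ≤ m) {h : ℝ → ℝ} (hh : IsProfile h)
    {k : ℝ} {x : ℤ → Letter} (hx : SmallEnergies m h k x) {ν : Measure ℝ}
    (hν : IsDiffractionMeasure (pointSet m x) ν) : ν {k} = 0 := by
  obtain ⟨γ, ⟨-, u, hu, hγ⟩, hνlf, hFT⟩ := hν
  have hmono := strictMono_tilingPoint x hm
  have hfinite : ν {k} ≠ ⊤ := isCompact_singleton.measure_lt_top.ne
  set c := ∫ t, h t with hc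
  have hc0 : 0 < c := hh.integral_pos
  have key : ∀ ε > 0, c ^ 2 * ν.real {k} ≤ ε := by
    intro ε hε
    obtain ⟨R, D, hR, hD, hsum⟩ := hx ε hε
    have hg := isWindow_window (k := k) hh hR
    set G := schwartzWindow hh k hR with hG
    obtain ⟨hν1, hγ1, heq⟩ := hFT (spectralSquare G)
    simp only [spectralSquare_apply] at hν1 heq
    rw [integral_complex_ofReal] at heq
    have hν2 : Integrable (fun t => ‖(𝓕 G) t‖ ^ 2) ν := by
      simpa only [RCLike.re_to_complex, Complex.ofReal_re] using hν1.re
    have h1 : c ^ 2 * ν.real {k} ≤ ∫ t, ‖(𝓕 G) t‖ ^ 2 ∂ν := by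
      have h2 := setIntegral_le_integral (s := {k}) hν2
        (Eventually.of_forall fun t => by positivity)
      rwa [integral_singleton, smul_eq_mul, hG, fourier_window, Complex.norm_real,
        Real.norm_of_nonneg hc0.le, mul_comm] at h2
    have h3 : ∫ t, ‖(𝓕 G) t‖ ^ 2 ∂ν = ∫ y, ((𝓕 (spectralSquare G)) y).re ∂γ := by
      have := integral_re hγ1
      simp only [RCLike.re_to_complex] at this
      rw [this, heq, Complex.ofReal_re]
    set f : ℝ → ℝ := fun y => ((𝓕 (spectralSquare G)) y).re with hf
    have hfcont : Continuous f := Complex.continuous_re.comp (SchwartzMap.continuous _)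
    have hfsupp : HasCompactSupport f := hasCompactSupport_fourier_spectralSquare hh hR
    set C := D * (lam m * (R⁻¹ * (R + 1)) ^ 2) + R * (R⁻¹ * (R + 1)) ^ 2 with hC
    have hbound : ∀ n : ℕ, ∫ y, f y ∂(finiteAutocorrelation (pointSet m x) n)
        ≤ (2 * n : ℝ)⁻¹ * (2 * ε * (n + 1) + C) := by
      intro n
      obtain ⟨α, N, hα, hN, hset⟩ := exists_pointSet_inter_closedBall x hm n
      have hinj : Set.InjOn (fun i : ℕ => tilingPoint m x (α + i)) (Finset.range N) :=
        fun a _ b _ hab => by simpa using hmono.injective hab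
      rw [integral_finiteAutocorrelation hset hfcont hfsupp]
      gcongr
      have h4 : ∑ y ∈ (Finset.range N).image (fun i : ℕ => tilingPoint m x (α + i)),
          ∑ z ∈ (Finset.range N).image (fun i : ℕ => tilingPoint m x (α + i)), f (y - z)
          = energy m (window h k R) (subword x α N) := by
        rw [Finset.sum_image hinj]
        simp only [Finset.sum_image hinj]
        have h5 := congrArg Complex.re (sum_sum_fourier_spectralSquare (k := k) hh hR
          (Finset.range N) fun i : ℕ => tilingPoint m x (α + i))
        rw [Complex.ofReal_re] at h5
        simp only [Complex.re_sum] at h5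
        rw [hf, ← integral_norm_sq_windowSum (tilingPoint m x α)]
        simp only [windowSum, patchSum_subword]
        exact h5
      rw [h4]
      refine (energy_subword_le hm hg hD x α N).trans ?_
      gcongr
      have h6 := hsum (n + 1)
      refine (sum_shift_range_le (f := fun j => headEnergy m (window h k R) (subword x j D))
        (fun j => headEnergy_nonneg _) hα hN).trans ?_
      push_cast at h6
      linarith [h6.1, h6.2]
    have hlim : Tendsto (fun n : ℕ => (2 * n : ℝ)⁻¹ * (2 * ε * (n + 1) + C)) atTop (𝓝 ε) := by
      have hi : Tendsto (fun n : ℕ => (n : ℝ)⁻¹) atTop (𝓝 0) := tendsto_inv_atTop_nhds_zero_nat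
      have h7 : Tendsto (fun n : ℕ => ε + (ε + C / 2) * (n : ℝ)⁻¹) atTop (𝓝 ε) := by
        simpa using (hi.const_mul (ε + C / 2)).const_add ε
      refine h7.congr' ?_
      filter_upwards [eventually_gt_atTop 0] with n hn
      have : (0 : ℝ) < n := by exact_mod_cast hn
      field_simp
      ring
    rw [h3] at h1
    exact h1.trans (le_of_tendsto_of_tendsto' (hγ f hfcont hfsupp)
      (hlim.comp hu.tendsto_atTop) fun n => hbound (u n))
  have h8 : c ^ 2 * ν.real {k} ≤ 0 := le_of_forall_pos_le_add fun ε hε => by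
    simpa using key ε hε
  have h9 : ν.real {k} ≤ 0 := by
    by_contra hcon
    have : 0 < c ^ 2 * ν.real {k} := mul_pos (by positivity) (not_le.1 hcon)
    linarith
  exact ((measureReal_eq_zero_iff hfinite).1 (le_antisymm h9 measureReal_nonneg))

end RNMS

end

theorem mainTheorem2 (m : ℕ) (hm : 1 ≤ m) (p : PMF (Fin (m + 1)))
    (k : ℝ) (hk : k ∉ RNMS.fourierModule m) :
    Tendsto (fun n : ℕ => ‖RNMS.meanAmplitude m p k n‖ ^ 2 / RNMS.lam m ^ (2 * n))
        atTop (𝓝 0) ∧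
      ∀ μ : Measure (ℤ → RNMS.Letter), RNMS.IsNobleMeansLaw m p μ →
        ∀ᵐ x ∂μ, ∀ ν : Measure ℝ,
          RNMS.IsDiffractionMeasure (RNMS.pointSet m x) ν → ν {k} = 0 := by
  constructor
  · have h := (RNMS.tendsto_letterAmplitude_div p k hm hk RNMS.Letter.b).pow 2
    rw [zero_pow two_ne_zero] at h
    refine h.congr fun n => ?_
    rw [RNMS.meanAmplitude_eq, div_pow, ← pow_mul, mul_comm n]
  · intro μ hμ
    obtain ⟨h, hh⟩ := RNMS.exists_isProfile
    filter_upwards [RNMS.ae_smallEnergies hm hμ hk hh] with x hx ν hν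
    exact hx.measure_singleton_eq_zero hm hh hν
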